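/- Let $\mathbb L=\mathbb Z[q^{\pm1},s^{\pm1}]$, let $V$ be the free $\mathbb L$-module with basis $v_0,v_1,v_2,\dots$, and define $\mathbb L$-linear maps $K,E$ on $V$ by $Kv_j=sq^{-2j}v_j$, $Ev_j=v_{j-1}$ (with $v_{-1}=0$). Let $[m]_q=\frac{q^m-q^{-m}}{q-q^{-1}}$, let $\left[{m\atop k}\right]_q=\frac{[m]_q!}{[k]_q!\,[m-k]_q!}\in\mathbb L$, and let $\mathsf R$ be the endomorphism of $V\otimes_{\mathbb L} V$ given by $$\mathsf R(v_i\otimes v_j)=s^{-(i+j)}\sum_{h=0}^{i}q^{2(i-h)(j+h)}\,q^{h(h-1)/2}\left[{h+j\atop j}\right]_q\prod_{k=0}^{h-1}\left(sq^{-k-j}-s^{-1}q^{k+j}\right)v_{j+h}\otimes v_{i-h}.$$ On $V^{\otimes n}$ let $K$ act as $K^{\otimes n}$ and $E$ as $\sum_{i=1}^n 1^{\otimes (i-1)}\otimes E\otimes K^{\otimes (n-i)}$, and for $l\ge 0$ let $$W_{n,l}=\ker(E)\cap\ker(K-s^nq^{-2l})\subset V^{\otimes n}.$$ Theorem. For all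 $n\ge 2$ and $l\ge 0$, the assignment $\sigma_i\mapsto 1^{\otimes (i-1)}\otimes\mathsf R\otimes 1^{\otimes (n-i-1)}$ $(1\le i\le n-1)$ restricts to a representation of the braid group $B_n$ on the $\mathbb L$-module $W_{n,l}$, and the $B_n$-representation $\overline{\mathbb L}\otimes_{\mathbb L}W_{n,l}$ over the fraction field $\overline{\mathbb L}=\mathbb Q(q,s)$ of $\mathbb L$ is irreducible. -/

import Mathlib

open scoped TensorProduct

noncomputable section

namespace VermaBraid

/-! ### The braid group -/

/-- The defining relations of the braid group on `n` strands: the generator with index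
`i : Fin (n - 1)` is the standard generator `σ_{i+1}`. -/
def braidRels (n : ℕ) : Set (FreeGroup (Fin (n - 1))) :=
  {r | ∃ i j : Fin (n - 1), (i : ℕ) + 1 = j ∧
      r = FreeGroup.of i * FreeGroup.of j * FreeGroup.of i *
        (FreeGroup.of j * FreeGroup.of i * FreeGroup.of j)⁻¹} ∪
  {r | ∃ i j : Fin (n - 1), (i : ℕ) + 1 < j ∧
      r = FreeGroup.of i * FreeGroup.of j * (FreeGroup.of j * FreeGroup.of i)⁻¹}

/-- Artin's braid group `B_n` on `n` strands. -/
abbrev BraidGroup (n : ℕ) : Type := PresentedGroup (braidRels n)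

/-- The standard generators of `B_n`. -/
def braidGen {n : ℕ} (i : Fin (n - 1)) : BraidGroup n := PresentedGroup.of i

/-- The first of the two adjacent strands on which the generator with index `i` acts. -/
def leftStrand {n : ℕ} (i : Fin (n - 1)) : Fin n := ⟨i, by omega⟩

/-- The second of the two adjacent strands on which the generator with index `i` acts. -/
def rightStrand {n : ℕ} (i : Fin (n - 1)) : Fin n := ⟨(i : ℕ) + 1, by omega⟩

/-! ### The ground ring and `q`-numbers -/

/-- The ring `𝕃 = ℤ[q^{±1}, s^{±1}]`, as `(ℤ[q^{±1}])[s^{±1}]`. -/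
def LRing : Type := LaurentPolynomial (LaurentPolynomial ℤ)

instance : CommRing LRing := inferInstanceAs (CommRing (LaurentPolynomial (LaurentPolynomial ℤ)))

instance : IsDomain LRing := inferInstanceAs (IsDomain (LaurentPolynomial (LaurentPolynomial ℤ)))

/-- The field of fractions `ℚ(q, s)` of `ℤ[q^{±1}, s^{±1}]`. -/
abbrev LField : Type := FractionRing LRing

/-- The power `q ^ k`, `k ∈ ℤ`. -/
def qPow (k : ℤ) : LRing :=
  (LaurentPolynomial.C (LaurentPolynomial.T k) : LaurentPolynomial (LaurentPolynomial ℤ))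

/-- The power `s ^ k`, `k ∈ ℤ`. -/
def sPow (k : ℤ) : LRing :=
  (LaurentPolynomial.T k : LaurentPolynomial (LaurentPolynomial ℤ))

/-- The `q`-number `[n]_q = (q^n - q^{-n}) / (q - q^{-1}) = ∑_{k < n} q^{n - 1 - 2k}`. -/
def qNum (n : ℕ) : LRing := ∑ k ∈ Finset.range n, qPow ((n : ℤ) - 1 - 2 * k)

/-- The `q`-factorial `[n]_q!`. -/
def qFact (n : ℕ) : LRing := ∏ k ∈ Finset.range n, qNum (k + 1)

/-- The symmetric `q`-binomial coefficient, an element of `ℤ[q^{±1}]`, by the `q`-Pascal rule;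
`qBinom_mul_qFact` shows that it is `[n]_q! / ([k]_q! [n - k]_q!)`. -/
def qBinom : ℕ → ℕ → LRing
  | _, 0 => 1
  | 0, _ + 1 => 0
  | n + 1, k + 1 =>
      qPow ((n : ℤ) - k) * qBinom n k + qPow (-((k : ℤ) + 1)) * qBinom n (k + 1)

/-! ### The generic Verma module -/

/-- The generic Verma module: the free `𝕃`-module on `v_0, v_1, …`. -/
def Verma : Type := ℕ →₀ LRing

instance : AddCommGroup Verma := inferInstanceAs (AddCommGroup (ℕ →₀ LRing))

instance : Module LRing Verma := inferInstanceAs (Module LRing (ℕ →₀ LRing))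

/-- The basis `v_0, v_1, …` of the generic Verma module. -/
def v : Module.Basis ℕ LRing Verma :=
  (Finsupp.basisSingleOne : Module.Basis ℕ LRing (ℕ →₀ LRing))

/-- `K v_j = s q^{-2j} v_j`. -/
def opK : Verma →ₗ[LRing] Verma :=
  v.constr LRing fun j : ℕ => (sPow 1 * qPow (-2 * (j : ℤ))) • v j

/-- `E v_0 = 0` and `E v_{j+1} = v_j`. -/
def opE : Verma →ₗ[LRing] Verma :=
  v.constr LRing fun j : ℕ => if j = 0 then 0 else v (j - 1)

/-- The coefficient of `v_{b+h} ⊗ v_{a-h}` in `R (v_a ⊗ v_b)`, for `0 ≤ h ≤ a`. -/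
def coeffR (a b h : ℕ) : LRing :=
  sPow (-((a : ℤ) + b)) * qPow (2 * ((a : ℤ) - h) * ((b : ℤ) + h)) *
    qPow ((h * (h - 1) / 2 : ℕ) : ℤ) * qBinom (h + b) b *
    ∏ k ∈ Finset.range h,
      (sPow 1 * qPow (-(k : ℤ) - b) - sPow (-1) * qPow ((k : ℤ) + b))

/-- The `R`-matrix on the tensor square of the Verma module, given on the basis
`v_a ⊗ v_b`. -/
def opR : Verma ⊗[LRing] Verma →ₗ[LRing] Verma ⊗[LRing] Verma :=
  (v.tensorProduct v).constr LRing
    fun p : ℕ × ℕ => ∑ h ∈ Finset.range (p.1 + 1),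
      coeffR p.1 p.2 h • (v (p.2 + h) ⊗ₜ[LRing] v (p.1 - h))

/-! ### Tensor powers of the Verma module -/

/-- The `n`-fold tensor power `V ^ {⊗ n}` over `𝕃`. -/
abbrev VermaPow (n : ℕ) : Type := ⨂[LRing]^n Verma

/-- The basis `v_{α_1} ⊗ ⋯ ⊗ v_{α_n}` of `V ^ {⊗ n}`. -/
def vermaPowBasis (n : ℕ) : Module.Basis (Fin n → ℕ) LRing (VermaPow n) :=
  Basis.piTensorProduct fun _ => v

/-- `K` acts on `V ^ {⊗ n}` by the iterated coproduct `K ⊗ ⋯ ⊗ K`. -/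
def powK (n : ℕ) : VermaPow n →ₗ[LRing] VermaPow n :=
  PiTensorProduct.map fun _ => opK

/-- `E` acts on `V ^ {⊗ n}` by the iterated coproduct
`∑_i 1 ⊗ ⋯ ⊗ 1 ⊗ E ⊗ K ⊗ ⋯ ⊗ K`, with `E` in position `i`. -/
def powE (n : ℕ) : VermaPow n →ₗ[LRing] VermaPow n :=
  ∑ i : Fin n, PiTensorProduct.map fun j =>
    if j < i then LinearMap.id else if j = i then opE else opK

/-- For distinct positions `i ≠ j` and vectors `x : Fin n → V`, the linear map
`V ⊗ V → V ^ {⊗ n}` which sends `y ⊗ z` to `x_1 ⊗ ⋯ ⊗ x_n` with `x_i` replaced by `y`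
and `x_j` replaced by `z`. -/
def insertTwo {n : ℕ} (x : Fin n → Verma) (i j : Fin n) (hij : i ≠ j) :
    Verma ⊗[LRing] Verma →ₗ[LRing] VermaPow n :=
  TensorProduct.lift <| LinearMap.mk₂ LRing
    (fun y z => PiTensorProduct.tprod LRing (Function.update (Function.update x i y) j z))
    (by intro y y' z; simp only [Function.update_comm hij, MultilinearMap.map_update_add])
    (by intro c y z; simp only [Function.update_comm hij, MultilinearMap.map_update_smul])
    (by intro y z z'; simp only [MultilinearMap.map_update_add])
    (by intro c y z; simp only [MultilinearMap.map_update_smul])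

theorem leftStrand_ne_rightStrand {n : ℕ} (i : Fin (n - 1)) :
    leftStrand i ≠ rightStrand i := by
  simp [leftStrand, rightStrand]

/-- The endomorphism `1 ⊗ ⋯ ⊗ 1 ⊗ R ⊗ 1 ⊗ ⋯ ⊗ 1` of `V ^ {⊗ n}`, with `R` in the two adjacent
positions `i`, `i + 1`, given on the basis `v_{α_1} ⊗ ⋯ ⊗ v_{α_n}`. -/
def braidOp (n : ℕ) (i : Fin (n - 1)) : VermaPow n →ₗ[LRing] VermaPow n :=
  (vermaPowBasis n).constr LRing fun α : Fin n → ℕ =>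
    insertTwo (fun k => v (α k)) (leftStrand i) (rightStrand i) (leftStrand_ne_rightStrand i)
      (opR (v (α (leftStrand i)) ⊗ₜ[LRing] v (α (rightStrand i))))

/-! ### Highest weight spaces -/

/-- The weight space `V_{n,l} = ker (K - s^n q^{-2l})`. -/
def weightSpace (n l : ℕ) : Submodule LRing (VermaPow n) :=
  LinearMap.ker (powK n - (sPow n * qPow (-2 * (l : ℤ))) • (LinearMap.id : VermaPow n →ₗ[LRing] VermaPow n))

/-- The highest weight space `W_{n,l} = ker E ∩ V_{n,l}`. -/
def highestWeightSpace (n l : ℕ) : Submodule LRing (VermaPow n) :=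
  LinearMap.ker (powE n) ⊓ weightSpace n l

/-- Extension of scalars of a representation along `R → A`. -/
def extendScalars {R G M : Type*} (A : Type*) [CommRing R] [CommRing A] [Algebra R A] [Group G]
    [AddCommGroup M] [Module R M] (ρ : Representation R G M) :
    Representation A G (A ⊗[R] M) :=
  (Module.End.baseChangeHom R A M).toRingHom.toMonoidHom.comp ρ

/-! ### The closed formula for the `q`-binomial coefficients -/

theorem qPow_add (a b : ℤ) : qPow (a + b) = qPow a * qPow b := by
  unfold qPow
  rw [LaurentPolynomial.T_add, map_mul]
  rfl

theorem qPow_zero : qPow 0 = 1 := by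
  unfold qPow
  rw [LaurentPolynomial.T_zero, map_one]
  rfl

theorem qNum_add (a b : ℕ) :
    qNum (a + b) = qPow b * qNum a + qPow (-(a : ℤ)) * qNum b := by
  unfold qNum
  rw [Finset.sum_range_add, Finset.mul_sum, Finset.mul_sum]
  congr 1 <;> refine Finset.sum_congr rfl fun k _ => ?_ <;> rw [← qPow_add] <;> congr 1 <;>
    push_cast <;> ring

theorem qBinom_eq_zero : ∀ n k : ℕ, n < k → qBinom n k = 0
  | _, 0, h => by omega
  | 0, k + 1, _ => by simp [qBinom]
  | n + 1, k + 1, h => by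
      simp [qBinom, qBinom_eq_zero n k (by omega), qBinom_eq_zero n (k + 1) (by omega)]

theorem qFact_succ (n : ℕ) : qFact (n + 1) = qNum (n + 1) * qFact n := by
  simp [qFact, Finset.prod_range_succ, mul_comm]

theorem qBinom_mul_qFact : ∀ k m : ℕ,
    qBinom (k + m) k * (qFact k * qFact m) = qFact (k + m)
  | 0, m => by cases m <;> simp [qBinom, qFact]
  | k + 1, 0 => by
      have h := qBinom_mul_qFact k 0
      simp only [Nat.add_zero] at h ⊢
      rw [qBinom, qBinom_eq_zero k (k + 1) (by omega), qFact_succ, sub_self, qPow_zero]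
      linear_combination qNum (k + 1) * h
  | k + 1, m + 1 => by
      have h1 := qBinom_mul_qFact k (m + 1)
      have h2 := qBinom_mul_qFact (k + 1) m
      have h3 := qNum_add (k + 1) (m + 1)
      have e : k + 1 + m = k + (m + 1) := by omega
      have e' : k + 1 + (m + 1) = k + (m + 1) + 1 := by omega
      have c : ((k + (m + 1) : ℕ) : ℤ) - k = ((m + 1 : ℕ) : ℤ) := by push_cast; ring
      have c' : -((k : ℤ) + 1) = -((k + 1 : ℕ) : ℤ) := by push_cast; ring
      have f1 := qFact_succ k
      have f2 := qFact_succ m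
      have f3 := qFact_succ (k + (m + 1))
      rw [e] at h2
      rw [e'] at h3 ⊢
      rw [qBinom, c, c', f3, h3]
      rw [f2] at h1 ⊢
      rw [f1] at h2 ⊢
      linear_combination qPow ((m + 1 : ℕ) : ℤ) * qNum (k + 1) * h1 +
        qPow (-((k + 1 : ℕ) : ℤ)) * qNum (m + 1) * h2

end VermaBraid

end

noncomputable section

namespace VermaBraid

/-! ### Scalars -/

theorem sPow_add (a b : ℤ) : sPow (a + b) = sPow a * sPow b :=
  LaurentPolynomial.T_add a b

theorem sPow_zero : sPow 0 = 1 := LaurentPolynomial.T_zero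

/-- The monomial `s ^ a * q ^ b`. -/
def mono (a b : ℤ) : LRing := sPow a * qPow b

theorem mono_mul (a b c d : ℤ) : mono a b * mono c d = mono (a + c) (b + d) := by
  simp only [mono, sPow_add, qPow_add]; ring

theorem mono_mul_assoc (a b c d : ℤ) (x : LRing) :
    mono a b * (mono c d * x) = mono (a + c) (b + d) * x := by
  rw [← mul_assoc, mono_mul]

theorem mono_zero : mono 0 0 = 1 := by simp [mono, sPow_zero, qPow_zero]

theorem qPow_eq_mono (b : ℤ) : qPow b = mono 0 b := by simp [mono, sPow_zero]

theorem isUnit_mono (a b : ℤ) : IsUnit (mono a b) :=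
  IsUnit.of_mul_eq_one (mono (-a) (-b)) (by rw [mono_mul, add_neg_cancel, add_neg_cancel, mono_zero])

theorem mono_ne_zero (a b : ℤ) : mono a b ≠ 0 := (isUnit_mono a b).ne_zero

/-- The specialization `q = 1`. -/
def specInt : LRing →+* LaurentPolynomial ℤ :=
  AddMonoidAlgebra.mapRingHom ℤ (LaurentPolynomial.eval₂ (Int.castRingHom ℤ) 1)

theorem specInt_C (p : LaurentPolynomial ℤ) :
    specInt (LaurentPolynomial.C p : LaurentPolynomial (LaurentPolynomial ℤ)) =
      LaurentPolynomial.C (LaurentPolynomial.eval₂ (Int.castRingHom ℤ) 1 p) :=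
  AddMonoidAlgebra.mapRingHom_single ..

theorem specInt_qPow (k : ℤ) : specInt (qPow k) = 1 := by
  rw [qPow, specInt_C, LaurentPolynomial.eval₂_T]; simp

theorem specInt_sPow (k : ℤ) : specInt (sPow k) = LaurentPolynomial.T k := by
  refine (AddMonoidAlgebra.mapRingHom_single ..).trans ?_
  rw [map_one]; rfl

/-- The constant extension of Laurent polynomials in `s` to Laurent polynomials in `q, s`. -/
def inclInt : LaurentPolynomial ℤ →+* LRing :=
  AddMonoidAlgebra.mapRingHom ℤ (LaurentPolynomial.C : ℤ →+* LaurentPolynomial ℤ)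

theorem inclInt_T (k : ℤ) : inclInt (LaurentPolynomial.T k) = sPow k := by
  refine (AddMonoidAlgebra.mapRingHom_single ..).trans ?_
  rw [map_one]; rfl

theorem qPow_sub_one_dvd (k : ℤ) : qPow 1 - 1 ∣ qPow k - 1 := by
  induction k using Int.induction_on with
  | zero => simp [qPow_zero]
  | succ n ih =>
    have : qPow ((n : ℤ) + 1) - 1 = qPow 1 * (qPow n - 1) + (qPow 1 - 1) := by
      rw [qPow_add]; ring
    rw [this]; exact dvd_add (Dvd.dvd.mul_left ih _) dvd_rfl
  | pred n ih =>
    have h : qPow (-(n : ℤ)) = qPow (-(n : ℤ) - 1) * qPow 1 := by rw [← qPow_add]; congr 1; ring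
    have : qPow (-(n : ℤ) - 1) - 1 = (qPow (-(n : ℤ)) - 1) - qPow (-(n : ℤ) - 1) * (qPow 1 - 1) := by
      rw [h]; ring
    rw [this]; exact dvd_sub ih (Dvd.intro_left _ rfl)

/-- The constants of `LRing` with respect to `s`. -/
def constHom : LaurentPolynomial ℤ →+* LRing :=
  (LaurentPolynomial.C : LaurentPolynomial ℤ →+* LaurentPolynomial (LaurentPolynomial ℤ))

theorem LRing_induction {P : LRing → Prop} (hadd : ∀ f g, P f → P g → P (f + g))
    (hmono : ∀ (c : ℤ) a b, P ((c : LRing) * mono a b)) (p : LRing) : P p := by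
  refine LaurentPolynomial.induction_on' (motive := fun p : LaurentPolynomial (LaurentPolynomial ℤ) =>
    P p) p hadd ?_
  intro k a
  change P (constHom a * sPow k)
  refine LaurentPolynomial.induction_on' (motive := fun p : LaurentPolynomial ℤ =>
    P (constHom p * sPow k)) a ?_ ?_
  · intro f g hf hg
    rw [map_add, add_mul]
    exact hadd _ _ hf hg
  · intro m c
    have := hmono c k m
    rw [map_mul, show (LaurentPolynomial.C c : LaurentPolynomial ℤ) = (c : LaurentPolynomial ℤ) from
      eq_intCast LaurentPolynomial.C c, map_intCast, mul_assoc]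
    rw [mono, mul_comm (sPow k)] at this
    exact this

theorem qPow_sub_one_dvd_sub (p : LRing) : qPow 1 - 1 ∣ p - inclInt (specInt p) := by
  refine LRing_induction (P := fun p => qPow 1 - 1 ∣ p - inclInt (specInt p)) ?_ ?_ p
  · intro f g hf hg
    rw [map_add, map_add, add_sub_add_comm]
    exact dvd_add hf hg
  · intro c a b
    rw [map_mul, map_mul, mono, map_mul, specInt_sPow, specInt_qPow, mul_one, inclInt_T, map_intCast,
      map_intCast, ← mul_sub, ← mul_sub_one]
    exact Dvd.dvd.mul_left (Dvd.dvd.mul_left (qPow_sub_one_dvd b) _) _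

theorem qPow_sub_one_dvd_of_specInt_eq_zero {p : LRing} (h : specInt p = 0) : qPow 1 - 1 ∣ p := by
  simpa [h] using qPow_sub_one_dvd_sub p

instance isNoetherianRing_laurent (R : Type*) [CommRing R] [IsNoetherianRing R] :
    IsNoetherianRing (LaurentPolynomial R) :=
  IsLocalization.isNoetherianRing (Submonoid.powers (Polynomial.X : Polynomial R)) _ inferInstance

instance : IsNoetherianRing LRing :=
  inferInstanceAs (IsNoetherianRing (LaurentPolynomial (LaurentPolynomial ℤ)))

/-- The field `ℚ(s)`. -/
abbrev SField : Type := FractionRing (LaurentPolynomial ℤ)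

/-- The specialization `q = 1`, with values in `ℚ(s)`. -/
def spec : LRing →+* SField := (algebraMap (LaurentPolynomial ℤ) SField).comp specInt

/-- The element `s` of `ℚ(s)`. -/
def sK : SField := spec (sPow 1)

theorem spec_qPow (k : ℤ) : spec (qPow k) = 1 := by simp [spec, specInt_qPow]

theorem sK_ne_zero : sK ≠ 0 := by
  have : sK * spec (sPow (-1)) = 1 := by
    rw [sK, ← map_mul, ← sPow_add, show (1 : ℤ) + -1 = 0 by norm_num, sPow_zero, map_one]
  exact left_ne_zero_of_mul_eq_one this

theorem spec_sPow (k : ℤ) : spec (sPow k) = sK ^ k := by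
  induction k using Int.induction_on with
  | zero => simp [sPow_zero]
  | succ n ih => rw [sPow_add, map_mul, ih, zpow_add_one₀ sK_ne_zero]; rfl
  | pred n ih =>
    have h : spec (sPow (-(n : ℤ) - 1)) * sK = sK ^ (-(n : ℤ)) := by
      rw [sK, ← map_mul, ← sPow_add, ← sK, ← ih]; congr 2; ring
    rw [zpow_sub_one₀ sK_ne_zero, ← h, mul_assoc, mul_inv_cancel₀ sK_ne_zero, mul_one]

theorem sK_zpow_ne_one {m : ℤ} (hm : m ≠ 0) : sK ^ m ≠ 1 := by
  rw [← spec_sPow]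
  intro h
  have h1 : (LaurentPolynomial.T m : LaurentPolynomial ℤ) = LaurentPolynomial.T 0 := by
    apply IsFractionRing.injective (LaurentPolynomial ℤ) SField
    rw [LaurentPolynomial.T_zero, map_one, ← h, ← specInt_sPow]; rfl
  have h2 := congrArg LaurentPolynomial.degree h1
  rw [LaurentPolynomial.degree_T, LaurentPolynomial.degree_T] at h2
  exact hm (by exact_mod_cast h2)

instance : CharZero (LaurentPolynomial ℤ) :=
  charZero_of_injective_ringHom (f := (LaurentPolynomial.C : ℤ →+* LaurentPolynomial ℤ))
    (fun a b h => by simpa using congrArg (LaurentPolynomial.eval₂ (RingHom.id ℤ) 1) h)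

instance : CharZero SField :=
  charZero_of_injective_ringHom (IsFractionRing.injective (LaurentPolynomial ℤ) SField)

theorem qPow_sub_one_dvd_of_spec_eq_zero {p : LRing} (h : spec p = 0) : qPow 1 - 1 ∣ p :=
  qPow_sub_one_dvd_of_specInt_eq_zero
    (IsFractionRing.injective (LaurentPolynomial ℤ) SField (by rw [map_zero]; exact h))

theorem spec_qPow_sub_one : spec (qPow 1 - 1) = 0 := by rw [map_sub, spec_qPow, map_one, sub_self]

theorem finiteMultiplicity_qPow_sub_one {p : LRing} (hp : p ≠ 0) :
    FiniteMultiplicity (qPow 1 - 1) p := by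
  refine FiniteMultiplicity.of_not_isUnit (fun h => ?_) hp
  have := h.map spec
  rw [spec_qPow_sub_one] at this
  exact not_isUnit_zero this

theorem qPow_sub_one_ne_zero : qPow 1 - 1 ≠ 0 := by
  intro h
  have h1 : (qPow 1 : LRing) = 1 := sub_eq_zero.mp h
  have h2 : (LaurentPolynomial.T 1 : LaurentPolynomial ℤ) = LaurentPolynomial.T 0 := by
    have : Function.Injective (LaurentPolynomial.C : LaurentPolynomial ℤ →+* _) :=
      fun a b h => by simpa using congrArg (LaurentPolynomial.eval₂ (RingHom.id _) 1) h
    apply this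
    rw [LaurentPolynomial.T_zero, map_one]
    exact h1
  have h3 := congrArg LaurentPolynomial.degree h2
  rw [LaurentPolynomial.degree_T, LaurentPolynomial.degree_T] at h3
  exact absurd h3 (by norm_num)

theorem qPow_injective : Function.Injective qPow := by
  intro a b h
  have : Function.Injective (LaurentPolynomial.C : LaurentPolynomial ℤ →+* _) :=
    fun a b h => by simpa using congrArg (LaurentPolynomial.eval₂ (RingHom.id _) 1) h
  have h3 := congrArg LaurentPolynomial.degree (this h)
  rw [LaurentPolynomial.degree_T, LaurentPolynomial.degree_T] at h3
  exact_mod_cast h3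

/-! ### The `q`-binomial coefficients -/

theorem spec_qNum (n : ℕ) : spec (qNum n) = n := by
  simp [qNum, spec_qPow]

theorem spec_qFact (n : ℕ) : spec (qFact n) = n.factorial := by
  induction n with
  | zero => simp [qFact]
  | succ n ih => rw [qFact_succ, map_mul, ih, spec_qNum, Nat.factorial_succ]; push_cast; ring

theorem qFact_ne_zero (n : ℕ) : qFact n ≠ 0 := fun h => by
  have := spec_qFact n
  rw [h, map_zero] at this
  exact n.factorial_ne_zero (by exact_mod_cast this.symm)

theorem spec_qBinom (k m : ℕ) : spec (qBinom (k + m) k) = ((k + m).choose k : SField) := by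
  have h := congrArg spec (qBinom_mul_qFact k m)
  rw [map_mul, map_mul, spec_qFact, spec_qFact, spec_qFact] at h
  have h2 : ((k + m).choose k * k.factorial * m.factorial : SField) = (k + m).factorial := by
    have := Nat.choose_mul_factorial_mul_factorial (Nat.le_add_right k m)
    rw [Nat.add_sub_cancel_left] at this
    exact_mod_cast this
  have h3 : (k.factorial * m.factorial : SField) ≠ 0 := by
    exact_mod_cast mul_ne_zero k.factorial_ne_zero m.factorial_ne_zero
  apply mul_right_cancel₀ h3
  rw [h, ← h2]; ring

theorem qBinom_zero_right (n : ℕ) : qBinom n 0 = 1 := by cases n <;> rfl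

theorem qBinom_self (n : ℕ) : qBinom n n = 1 := by
  have h := qBinom_mul_qFact n 0
  rw [Nat.add_zero] at h
  refine mul_right_cancel₀ (qFact_ne_zero n) ?_
  simpa [qFact] using h

/-- Multiplicativity of trinomial coefficients. -/
theorem qBinom_mul_qBinom (g h c : ℕ) :
    qBinom (g + (c + h)) (c + h) * qBinom (h + c) c =
      qBinom (g + h + c) c * qBinom (g + h) g := by
  have h1 := qBinom_mul_qFact (c + h) g
  have h2 := qBinom_mul_qFact c h
  have h3 := qBinom_mul_qFact c (g + h)
  have h4 := qBinom_mul_qFact g h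
  rw [show c + h + g = g + (c + h) by ring] at h1
  rw [show c + h = h + c by ring] at h2 h1 ⊢
  rw [show c + (g + h) = g + (h + c) by ring] at h3
  rw [show g + h + c = g + (h + c) by ring]
  refine mul_right_cancel₀
    (mul_ne_zero (qFact_ne_zero c) (mul_ne_zero (qFact_ne_zero g) (qFact_ne_zero h))) ?_
  calc _ = qBinom (g + (h + c)) (h + c) * (qBinom (h + c) c * (qFact c * qFact h) * qFact g) := by ring
    _ = qBinom (g + (h + c)) c * (qFact c * (qBinom (g + h) g * (qFact g * qFact h))) := by
      rw [h2, h1, h4, h3]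
    _ = _ := by ring

theorem qBinom_succ_succ (n k : ℕ) : qBinom (n + 1) (k + 1) =
    qPow ((n : ℤ) - k) * qBinom n k + qPow (-((k : ℤ) + 1)) * qBinom n (k + 1) := rfl

theorem qPow_sub_mul_qBinom (n k : ℕ) :
    (qPow (k + 1) - qPow (-(k + 1))) * qBinom n (k + 1) =
      (qPow (n - k) - qPow (k - n)) * qBinom n k := by
  have key (x y : ℤ) : qPow x * qPow y = qPow (x + y) := (qPow_add x y).symm
  induction n generalizing k with
  | zero =>
    cases k with
    | zero => simp [qBinom]
    | succ k => simp [qBinom]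
  | succ n ih =>
    rw [qBinom_succ_succ]
    have e1 := ih k
    have e : (qPow (n + 1 - k) - qPow (k - (n + 1))) * qBinom (n + 1) k =
        (qPow (n + 1) - qPow (-(n + 1))) * qBinom n k := by
      cases k with
      | zero => simp [qBinom_zero_right]
      | succ j =>
        rw [qBinom_succ_succ]
        have e2 := ih j
        push_cast
        have a1 : qPow ((n : ℤ) + 1) = qPow (n - j) * qPow (j + 1) := by rw [key]; congr 1; ring
        have a2 : qPow (-((n : ℤ) + 1)) = qPow (j - n) * qPow (-(j + 1)) := by rw [key]; congr 1; ring
        have a3 : qPow ((n : ℤ) + 1 - (j + 1)) = qPow (n - j) := by congr 1; ring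
        have a4 : qPow ((j : ℤ) + 1 - (n + 1)) = qPow (j - n) := by congr 1; ring
        rw [a1, a2, a3, a4]
        linear_combination (-qPow (n - j)) * e2
    push_cast
    rw [e]
    have a1 : qPow ((n : ℤ) + 1) = qPow (k + 1) * qPow (n - k) := by rw [key]; congr 1; ring
    have a2 : qPow (-((n : ℤ) + 1)) = qPow (-(k + 1)) * qPow (k - n) := by rw [key]; congr 1; ring
    rw [a1, a2]
    linear_combination qPow (-(k + 1)) * e1

/-- The second `q`-Pascal rule. -/
theorem qBinom_succ_succ' (n k : ℕ) : qBinom (n + 1) (k + 1) =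
    qPow ((k : ℤ) - n) * qBinom n k + qPow ((k : ℤ) + 1) * qBinom n (k + 1) := by
  rw [qBinom_succ_succ]
  linear_combination (-1 : LRing) * qPow_sub_mul_qBinom n k

/-! ### The coefficients of the `R`-matrix -/

/-- The eigenvalue `s q ^ {-2a}` of `K` on `v_a`. -/
def kap (a : ℕ) : LRing := mono 1 (-2 * (a : ℤ))

/-- The factor `s q ^ {-m} - s⁻¹ q ^ m`. -/
def curly (m : ℤ) : LRing := mono 1 (-m) - mono (-1) m

/-- The product of the factors `curly m` for `b ≤ m < b + h`. -/
def curlyProd (b h : ℕ) : LRing := ∏ k ∈ Finset.range h, curly ((k : ℤ) + b)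

theorem curlyProd_zero (b : ℕ) : curlyProd b 0 = 1 := by simp [curlyProd]

theorem curlyProd_succ (b h : ℕ) : curlyProd b (h + 1) = curlyProd b h * curly ((h : ℤ) + b) := by
  simp [curlyProd, Finset.prod_range_succ]

theorem curlyProd_succ' (b h : ℕ) : curlyProd b (h + 1) = curly b * curlyProd (b + 1) h := by
  have h0 (k : ℕ) : curly (((k + 1 : ℕ) : ℤ) + b) = curly ((k : ℤ) + (b + 1 : ℕ)) := by
    rw [Nat.cast_succ, Nat.cast_succ, add_right_comm, add_assoc]
  simp only [curlyProd, Finset.prod_range_succ', h0, Nat.cast_zero, zero_add]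
  exact mul_comm _ _

theorem curlyProd_add (b h g : ℕ) : curlyProd b (h + g) = curlyProd b h * curlyProd (b + h) g := by
  have h0 (k : ℕ) : curly (((h + k : ℕ) : ℤ) + b) = curly ((k : ℤ) + (b + h : ℕ)) := by
    rw [Nat.cast_add, Nat.cast_add, add_comm (h : ℤ), add_assoc, add_comm (h : ℤ)]
  simp only [curlyProd, Finset.prod_range_add, h0]

/-- The triangular number `h (h - 1) / 2`. -/
def tri (h : ℕ) : ℤ := ((h * (h - 1) / 2 : ℕ) : ℤ)

theorem tri_succ (h : ℕ) : tri (h + 1) = tri h + h := by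
  have := Nat.triangle_succ h
  simp only [tri, this]; push_cast; rfl

theorem tri_zero : tri 0 = 0 := rfl

theorem tri_add (g h : ℕ) : tri (g + h) = tri g + tri h + g * h := by
  induction h with
  | zero => simp [tri_zero]
  | succ h ih => rw [← add_assoc, tri_succ, tri_succ, ih]; push_cast; ring

theorem coeffR_eq (a b h : ℕ) : coeffR a b h =
    mono (-((a : ℤ) + b)) (2 * ((a : ℤ) - h) * (b + h) + tri h) *
      (qBinom (h + b) b * curlyProd b h) := by
  have : curlyProd b h = ∏ k ∈ Finset.range h,
      (sPow 1 * qPow (-(k : ℤ) - b) - sPow (-1) * qPow ((k : ℤ) + b)) := by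
    refine Finset.prod_congr rfl fun k _ => ?_
    rw [curly, mono, mono]; congr 3; ring
  rw [coeffR, this, mono, qPow_add, tri]
  ring

theorem coeffR_zero_right (a b : ℕ) :
    coeffR a b 0 = mono (-((a : ℤ) + b)) (2 * a * b) := by
  rw [coeffR_eq, curlyProd_zero, Nat.zero_add, qBinom_self, tri_zero]
  simp

/-- The coefficient identity behind the commutation of `R` with `E`. -/
theorem coeffR_comm_succ (b d h : ℕ) :
    coeffR (h + d + 1) (b + 1) (h + 1) * kap d + coeffR (h + d + 1) (b + 1) h =
      kap (b + 1) * coeffR (h + d) (b + 1) h + coeffR (h + d + 1) b (h + 1) := by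
  set X : LRing := mono (-((h : ℤ) + d + b + 2)) (2 * d * (b + h + 1) + tri h) * curlyProd (b + 1) h with hX
  have e1 : coeffR (h + d + 1) (b + 1) (h + 1) * kap d = X *
      (mono 2 (-(b + 1)) - mono 0 (b + 1 + 2 * h)) * qBinom (h + b + 2) (b + 1) := by
    rw [coeffR_eq, kap, curlyProd_succ, tri_succ, hX, curly,
      show mono 2 (-((b : ℤ) + 1)) = mono 1 h * mono 1 (-((h : ℤ) + (b + 1))) by
        rw [mono_mul]; congr 1; ring,
      show mono 0 ((b : ℤ) + 1 + 2 * h) = mono 1 h * mono (-1) ((h : ℤ) + (b + 1)) by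
        rw [mono_mul]; congr 1; ring]
    rw [show h + 1 + (b + 1) = h + b + 2 by ring]
    push_cast
    have : mono (-((h : ℤ) + d + b + 2)) (2 * d * (b + h + 1) + tri h) * mono 1 h =
      mono (-((h : ℤ) + d + 1 + (b + 1))) (2 * (h + d + 1 - (h + 1)) * (b + 1 + (h + 1)) + (tri h + h)) *
        mono 1 (-2 * (d : ℤ)) := by
      rw [mono_mul, mono_mul]; congr 1 <;> ring
    linear_combination (-(mono 1 (-((h : ℤ) + (b + 1))) - mono (-1) ((h : ℤ) + (b + 1))) *
      qBinom (h + b + 2) (b + 1) * curlyProd (b + 1) h) * this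
  have e2 : coeffR (h + d + 1) (b + 1) h = X * mono 0 (2 * (b + 1 + h)) * qBinom (h + b + 1) (b + 1) := by
    rw [coeffR_eq, hX, ← add_assoc]
    push_cast
    have : mono (-((h : ℤ) + d + b + 2)) (2 * d * (b + h + 1) + tri h) * mono 0 (2 * (b + 1 + h)) =
      mono (-((h : ℤ) + d + 1 + (b + 1))) (2 * (h + d + 1 - h) * (b + 1 + h) + tri h) := by
      rw [mono_mul]; congr 1 <;> ring
    linear_combination (-qBinom (h + b + 1) (b + 1) * curlyProd (b + 1) h) * this
  have e3 : kap (b + 1) * coeffR (h + d) (b + 1) h =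
      X * mono 2 (-2 * (b + 1)) * qBinom (h + b + 1) (b + 1) := by
    rw [coeffR_eq, kap, hX, ← add_assoc]
    push_cast
    have : mono (-((h : ℤ) + d + b + 2)) (2 * d * (b + h + 1) + tri h) * mono 2 (-2 * (b + 1)) =
      mono 1 (-2 * ((b : ℤ) + 1)) *
        mono (-((h : ℤ) + d + (b + 1))) (2 * (h + d - h) * (b + 1 + h) + tri h) := by
      rw [mono_mul, mono_mul]; congr 1 <;> ring
    linear_combination (-qBinom (h + b + 1) (b + 1) * curlyProd (b + 1) h) * this
  have e4 : coeffR (h + d + 1) b (h + 1) =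
      X * (mono 2 (h - b) - mono 0 (h + b)) * qBinom (h + b + 1) b := by
    rw [coeffR_eq, curlyProd_succ', tri_succ, hX, curly,
      show mono 2 ((h : ℤ) - b) = mono 1 h * mono 1 (-(b : ℤ)) by
        rw [mono_mul]; congr 1,
      show mono 0 ((h : ℤ) + b) = mono 1 h * mono (-1) b by
        rw [mono_mul]; congr 1]
    rw [show h + 1 + b = h + b + 1 by ring]
    push_cast
    have : mono (-((h : ℤ) + d + b + 2)) (2 * d * (b + h + 1) + tri h) * mono 1 h =
      mono (-((h : ℤ) + d + 1 + b)) (2 * (h + d + 1 - (h + 1)) * (b + (h + 1)) + (tri h + h)) := by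
      rw [mono_mul]; congr 1 <;> ring
    linear_combination (-(mono 1 (-(b : ℤ)) - mono (-1) (b : ℤ)) *
      qBinom (h + b + 1) b * curlyProd (b + 1) h) * this
  rw [e1, e2, e3, e4]
  have p1 := qBinom_succ_succ (h + b + 1) b
  have p2 := qBinom_succ_succ' (h + b + 1) b
  rw [qPow_eq_mono, qPow_eq_mono] at p1 p2
  push_cast at p1 p2
  have k1 : mono 2 (-((b : ℤ) + 1)) * qBinom (h + b + 2) (b + 1) =
      mono 2 (h - b) * qBinom (h + b + 1) b + mono 2 (-2 * (b + 1)) * qBinom (h + b + 1) (b + 1) := by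
    rw [show h + b + 2 = h + b + 1 + 1 by ring, p1, mul_add, mono_mul_assoc, mono_mul_assoc]
    congr 3 <;> ring
  have k2 : mono 0 ((b : ℤ) + 1 + 2 * h) * qBinom (h + b + 2) (b + 1) =
      mono 0 (h + b) * qBinom (h + b + 1) b + mono 0 (2 * (b + 1 + h)) * qBinom (h + b + 1) (b + 1) := by
    rw [show h + b + 2 = h + b + 1 + 1 by ring, p2, mul_add, mono_mul_assoc, mono_mul_assoc]
    congr 3 <;> ring
  linear_combination X * k1 - X * k2

theorem coeffR_comm_zero (d h : ℕ) :
    coeffR (h + d + 1) 0 (h + 1) * kap d + coeffR (h + d + 1) 0 h =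
      kap 0 * coeffR (h + d) 0 h := by
  rw [coeffR_eq, coeffR_eq, coeffR_eq, curlyProd_succ, tri_succ, curly, qBinom_zero_right,
    qBinom_zero_right, kap, kap]
  push_cast
  have e1 : mono (-((h : ℤ) + d + 1 + 0)) (2 * (h + d + 1 - (h + 1)) * (0 + (h + 1)) + (tri h + h)) *
      mono 1 (-((h : ℤ) + 0)) * mono 1 (-2 * d) =
      mono 1 0 * mono (-((h : ℤ) + d + 0)) (2 * (h + d - h) * (0 + h) + tri h) := by
    simp only [mono_mul]; congr 1 <;> ring
  have e2 : mono (-((h : ℤ) + d + 1 + 0)) (2 * (h + d + 1 - (h + 1)) * (0 + (h + 1)) + (tri h + h)) *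
      mono (-1) ((h : ℤ) + 0) * mono 1 (-2 * d) =
      mono (-((h : ℤ) + d + 1 + 0)) (2 * (h + d + 1 - h) * (0 + h) + tri h) := by
    simp only [mono_mul]; congr 1; ring
  linear_combination curlyProd 0 h * e1 - curlyProd 0 h * e2

/-! ### Operators on families of vectors

An operator on the span of vectors `f a b` which is given on these vectors by an explicit formula
is the same as an operator on families `f : ℕ → ℕ → Z`; composition is reversed. -/

section Families

variable {Z : Type*} [AddCommGroup Z] [Module LRing Z]

/-- The `R`-matrix on families. -/
def famR : (ℕ → ℕ → Z) →ₗ[LRing] (ℕ → ℕ → Z) where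
  toFun f a b := ∑ h ∈ Finset.range (a + 1), coeffR a b h • f (b + h) (a - h)
  map_add' f g := by ext a b; simp [Finset.sum_add_distrib]
  map_smul' c f := by ext a b; simp [Finset.smul_sum, smul_comm c]

/-- The operator `E ⊗ K` on families. -/
def famEK : Module.End LRing (ℕ → ℕ → Z) where
  toFun f a b := if a = 0 then 0 else kap b • f (a - 1) b
  map_add' f g := by ext a b; by_cases h : a = 0 <;> simp [h]
  map_smul' c f := by ext a b; by_cases h : a = 0 <;> simp [h, smul_comm c]

/-- The operator `1 ⊗ E` on families. -/
def famE : Module.End LRing (ℕ → ℕ → Z) where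
  toFun f a b := if b = 0 then 0 else f a (b - 1)
  map_add' f g := by ext a b; by_cases h : b = 0 <;> simp [h]
  map_smul' c f := by ext a b; by_cases h : b = 0 <;> simp [h]

/-- The action of `E` on the tensor square, on families. -/
def famDE : Module.End LRing (ℕ → ℕ → Z) := famEK + famE

theorem famDE_apply (f : ℕ → ℕ → Z) : famDE f = famEK f + famE f := rfl

theorem famR_apply (f : ℕ → ℕ → Z) (a b : ℕ) :
    famR f a b = ∑ h ∈ Finset.range (a + 1), coeffR a b h • f (b + h) (a - h) := rfl

theorem famEK_zero (f : ℕ → ℕ → Z) (b : ℕ) : famEK f 0 b = 0 := rfl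

theorem famEK_succ (f : ℕ → ℕ → Z) (a b : ℕ) : famEK f (a + 1) b = kap b • f a b := rfl

theorem famE_zero (f : ℕ → ℕ → Z) (a : ℕ) : famE f a 0 = 0 := rfl

theorem famE_succ (f : ℕ → ℕ → Z) (a b : ℕ) : famE f a (b + 1) = f a b := rfl

/-- The `R`-matrix commutes with the action of `E` on the tensor square. -/
theorem famR_comm (f : ℕ → ℕ → Z) :
    famR (famDE f) = famDE (famR f) := by
  have hk0 (a : ℕ) : coeffR a 0 0 = mono (-(a : ℤ)) 0 := by rw [coeffR_zero_right]; simp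
  funext a b
  simp only [famDE_apply, map_add, Pi.add_apply]
  have t2 : famR (famE f) a b =
      ∑ h ∈ Finset.range a, coeffR a b h • f (b + h) (a - 1 - h) := by
    rw [famR_apply, Finset.sum_range_succ, Nat.sub_self, famE_zero, smul_zero, add_zero]
    refine Finset.sum_congr rfl fun h hh => ?_
    rw [Finset.mem_range] at hh
    obtain ⟨d, rfl⟩ := Nat.exists_eq_add_of_lt hh
    rw [show h + d + 1 - h = d + 1 by omega, famE_succ, show h + d + 1 - 1 - h = d by omega]
  have t3 : famEK (famR f) a b =
      ∑ h ∈ Finset.range a, (kap b * coeffR (a - 1) b h) • f (b + h) (a - 1 - h) := by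
    cases a with
    | zero => simp [famEK_zero]
    | succ a => simp [famEK_succ, famR_apply, Finset.smul_sum, mul_smul]
  cases b with
  | zero =>
    have t1 : famR (famEK f) a 0 =
        ∑ h ∈ Finset.range a, (coeffR a 0 (h + 1) * kap (a - 1 - h)) • f (0 + h) (a - 1 - h) := by
      rw [famR_apply, Finset.sum_range_succ', famEK_zero, smul_zero, add_zero]
      refine Finset.sum_congr rfl fun h hh => ?_
      rw [← add_assoc, famEK_succ, smul_smul, show a - (h + 1) = a - 1 - h by omega]
    rw [famE_zero, add_zero, t1, t2, t3, ← Finset.sum_add_distrib]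
    refine Finset.sum_congr rfl fun h hh => ?_
    rw [Finset.mem_range] at hh
    obtain ⟨d, rfl⟩ := Nat.exists_eq_add_of_lt hh
    rw [show h + d + 1 - 1 - h = d by omega, Nat.add_sub_cancel, ← add_smul, coeffR_comm_zero]
  | succ b =>
    have t1 : famR (famEK f) a (b + 1) =
        (∑ h ∈ Finset.range a, (coeffR a (b + 1) (h + 1) * kap (a - 1 - h)) •
          f (b + 1 + h) (a - 1 - h)) + (coeffR a (b + 1) 0 * kap a) • f b a := by
      rw [famR_apply, Finset.sum_range_succ', Nat.add_zero, famEK_succ, smul_smul, Nat.sub_zero]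
      refine congrArg₂ (· + ·) (Finset.sum_congr rfl fun h hh => ?_) rfl
      rw [← add_assoc, famEK_succ, smul_smul, show a - (h + 1) = a - 1 - h by omega]
    have t4 : famE (famR f) a (b + 1) =
        (∑ h ∈ Finset.range a, coeffR a b (h + 1) • f (b + 1 + h) (a - 1 - h)) +
          coeffR a b 0 • f b a := by
      rw [famE_succ, famR_apply, Finset.sum_range_succ', Nat.add_zero, Nat.sub_zero]
      refine congrArg₂ (· + ·) (Finset.sum_congr rfl fun h hh => ?_) rfl
      rw [show b + (h + 1) = b + 1 + h by ring, show a - (h + 1) = a - 1 - h by omega]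
    have t5 : coeffR a (b + 1) 0 * kap a = coeffR a b 0 := by
      rw [coeffR_zero_right, coeffR_zero_right, kap, mono_mul]; push_cast; congr 1 <;> ring
    rw [t1, t2, t3, t4, t5, add_right_comm, ← add_assoc]
    refine congrArg₂ (· + ·) ?_ rfl
    rw [← Finset.sum_add_distrib, ← Finset.sum_add_distrib]
    refine Finset.sum_congr rfl fun h hh => ?_
    rw [Finset.mem_range] at hh
    obtain ⟨d, rfl⟩ := Nat.exists_eq_add_of_lt hh
    rw [show h + d + 1 - 1 - h = d by omega, Nat.add_sub_cancel, ← add_smul, ← add_smul,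
      coeffR_comm_succ]

theorem famE_famEK (f : ℕ → ℕ → Z) : famE (famEK f) = qPow 2 • famEK (famE f) := by
  funext a b
  cases a with
  | zero =>
    cases b with
    | zero => simp [famE_zero, famEK_zero]
    | succ b => simp [famE_succ, famEK_zero]
  | succ a =>
    cases b with
    | zero => simp [famE_zero, famEK_succ]
    | succ b =>
      simp only [famE_succ, famEK_succ, Pi.smul_apply, smul_smul]
      congr 1
      rw [kap, kap, qPow_eq_mono, mono_mul]; push_cast; congr 1; ring

theorem famE_famEK_pow (g : ℕ) (f : ℕ → ℕ → Z) :
    famE ((famEK ^ g) f) = qPow (2 * g) • (famEK ^ g) (famE f) := by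
  induction g with
  | zero => simp [qPow_zero]
  | succ g ih =>
    rw [pow_succ', Module.End.mul_apply, Module.End.mul_apply, famE_famEK, ih, map_smul, smul_smul,
      ← qPow_add]
    congr 2; push_cast; ring

/-- The `q`-binomial theorem for the powers of `E` on the tensor square. -/
theorem famDE_pow (H : ℕ) (f : ℕ → ℕ → Z) :
    (famDE ^ H) f = ∑ p ∈ Finset.HasAntidiagonal.antidiagonal H,
      (qPow (p.1 * p.2) * qBinom H p.1) • (famEK ^ p.1) ((famE ^ p.2) f) := by
  induction H with
  | zero => simp [qBinom, qPow_zero]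
  | succ H ih =>
    rw [pow_succ', Module.End.mul_apply, ih, map_sum]
    have step (p : ℕ × ℕ) : famDE ((qPow (p.1 * p.2) * qBinom H p.1) •
        (famEK ^ p.1) ((famE ^ p.2) f)) =
        (qPow (p.1 * p.2) * qBinom H p.1) • (famEK ^ (p.1 + 1)) ((famE ^ p.2) f) +
        (qPow (p.1 * p.2 + 2 * p.1) * qBinom H p.1) • (famEK ^ p.1) ((famE ^ (p.2 + 1)) f) := by
      rw [map_smul, famDE_apply, famE_famEK_pow, smul_add, smul_smul, pow_succ',
        Module.End.mul_apply, pow_succ' famE, Module.End.mul_apply, qPow_add]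
      congr 2; ring
    simp only [step]
    rw [Finset.sum_add_distrib]
    have d1 : ∑ p ∈ Finset.HasAntidiagonal.antidiagonal H,
        (qPow (p.1 * p.2) * qBinom H p.1) • (famEK ^ (p.1 + 1)) ((famE ^ p.2) f) =
        ∑ p ∈ Finset.HasAntidiagonal.antidiagonal (H + 1), (if p.1 = 0 then 0 else
          qPow ((p.1 - 1) * p.2) * qBinom H (p.1 - 1)) • (famEK ^ p.1) ((famE ^ p.2) f) := by
      rw [Finset.Nat.sum_antidiagonal_succ]
      simp
    have d2 : ∑ p ∈ Finset.HasAntidiagonal.antidiagonal H,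
        (qPow (p.1 * p.2 + 2 * p.1) * qBinom H p.1) • (famEK ^ p.1) ((famE ^ (p.2 + 1)) f) =
        ∑ p ∈ Finset.HasAntidiagonal.antidiagonal (H + 1), (if p.2 = 0 then 0 else
          qPow (p.1 * (p.2 - 1) + 2 * p.1) * qBinom H p.1) • (famEK ^ p.1) ((famE ^ p.2) f) := by
      rw [Finset.Nat.sum_antidiagonal_succ']
      simp
    rw [d1, d2, ← Finset.sum_add_distrib]
    refine Finset.sum_congr rfl fun p hp => ?_
    rw [Finset.HasAntidiagonal.mem_antidiagonal] at hp
    rw [← add_smul]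
    congr 1
    obtain ⟨g, h⟩ := p
    simp only at hp ⊢
    cases g with
    | zero =>
      obtain rfl : h = H + 1 := by omega
      simp [qBinom_zero_right, qPow_zero]
    | succ g =>
      rw [qBinom_succ_succ']
      have key (x y : ℤ) : qPow x * qPow y = qPow (x + y) := (qPow_add x y).symm
      cases h with
      | zero =>
        obtain rfl : g = H := by omega
        rw [qBinom_eq_zero g (g + 1) (by omega)]
        simp [qPow_zero]
      | succ h =>
        obtain rfl : H = g + h + 1 := by omega
        simp only [Nat.succ_ne_zero, if_false, Nat.add_sub_cancel]
        push_cast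
        have a1 : qPow (((g : ℤ) + 1) * (h + 1)) * qPow (g - (g + h + 1)) = qPow (g * (h + 1)) := by
          rw [key]; congr 1; ring
        have a2 : qPow (((g : ℤ) + 1) * (h + 1)) * qPow (g + 1) =
            qPow (((g : ℤ) + 1) * h + 2 * (g + 1)) := by
          rw [key]; congr 1; ring
        rw [show ((g : ℤ) + 1 - 1) = g by ring, show ((h : ℤ) + 1 - 1) = h by ring, ← a1, ← a2]
        ring

theorem famEK_pow_apply (g : ℕ) (f : ℕ → ℕ → Z) (a b : ℕ) :
    (famEK ^ g) f a b = if g ≤ a then mono g (-2 * (b : ℤ) * g) • f (a - g) b else 0 := by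
  induction g generalizing a with
  | zero => simp [mono_zero]
  | succ g ih =>
    rw [pow_succ', Module.End.mul_apply]
    cases a with
    | zero => simp [famEK_zero]
    | succ a =>
      rw [famEK_succ, ih]
      simp only [Nat.add_le_add_iff_right, Nat.add_sub_add_right]
      split_ifs
      · rw [smul_smul, kap, mono_mul]; push_cast; congr 2 <;> ring
      · simp

theorem famE_pow_apply (h : ℕ) (f : ℕ → ℕ → Z) (a b : ℕ) :
    (famE ^ h) f a b = if h ≤ b then f a (b - h) else 0 := by
  induction h generalizing b with
  | zero => simp
  | succ h ih =>
    rw [pow_succ', Module.End.mul_apply]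
    cases b with
    | zero => simp [famE_zero]
    | succ b =>
      rw [famE_succ, ih]
      simp only [Nat.add_le_add_iff_right, Nat.add_sub_add_right]

/-- The coefficients of the braiding of a vector of degree `m` in a module with `v_c`. -/
def coeffHex (m c H : ℕ) : LRing :=
  mono (-((m : ℤ) + 2 * c + H)) (2 * ((m : ℤ) - H) * (c + H) + tri H) *
    (qBinom (H + c) c * curlyProd c H)

theorem coeffR_mul_coeffR (a b c g h : ℕ) :
    coeffR b c h * coeffR a (c + h) g = coeffHex (a + b) c (g + h) *
      (qPow (g * h) * qBinom (g + h) g * mono g (-2 * (b : ℤ) * g)) := by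
  have hb := qBinom_mul_qBinom g h c
  rw [coeffR_eq, coeffR_eq, coeffHex, qPow_eq_mono, tri_add, add_comm g h, curlyProd_add]
  rw [add_comm g h] at hb
  push_cast
  have e : mono (-((b : ℤ) + c)) (2 * (b - h) * (c + h) + tri h) *
      mono (-((a : ℤ) + (c + h))) (2 * (a - g) * (c + h + g) + tri g) =
      mono (-((a : ℤ) + b + 2 * c + (h + g)))
        (2 * (a + b - (h + g)) * (c + (h + g)) + (tri g + tri h + g * h)) *
      mono 0 (g * h) * mono g (-2 * (b : ℤ) * g) := by
    simp only [mono_mul]; congr 1 <;> ring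
  linear_combination (qBinom (h + c) c * curlyProd c h *
      (qBinom (g + (c + h)) (c + h) * curlyProd (c + h) g)) * e +
    (mono (-((a : ℤ) + b + 2 * c + (h + g)))
        (2 * (a + b - (h + g)) * (c + (h + g)) + (tri g + tri h + g * h)) *
      mono 0 (g * h) * mono g (-2 * (b : ℤ) * g)) * curlyProd c h * curlyProd (c + h) g * hb

theorem sum_range_antidiagonal {M : Type*} [AddCommMonoid M] (a b : ℕ) (F : ℕ × ℕ → M)
    (hF : ∀ p : ℕ × ℕ, ¬ (p.1 ≤ a ∧ p.2 ≤ b) → F p = 0) :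
    ∑ H ∈ Finset.range (a + b + 1), ∑ p ∈ Finset.HasAntidiagonal.antidiagonal H, F p =
      ∑ h ∈ Finset.range (b + 1), ∑ g ∈ Finset.range (a + 1), F (g, h) := by
  rw [Finset.sum_comm, ← Finset.sum_product',
    ← Finset.sum_fiberwise_of_maps_to (s := Finset.range (a + 1) ×ˢ Finset.range (b + 1))
      (t := Finset.range (a + b + 1)) (g := fun p => p.1 + p.2)]
  · refine Finset.sum_congr rfl fun H _ => (Finset.sum_subset ?_ ?_).symm
    · intro p hp
      simpa using (Finset.mem_filter.mp hp).2
    · intro p hp hn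
      refine hF p fun hab => hn ?_
      rw [Finset.HasAntidiagonal.mem_antidiagonal] at hp
      simp only [Finset.mem_filter, Finset.mem_product, Finset.mem_range]
      omega
  · intro p hp
    simp only [Finset.mem_product, Finset.mem_range] at hp ⊢
    omega

/-- The hexagon identity: moving `v_c` past `v_b` and then past `v_a` is the braiding of
`v_a ⊗ v_b` with `v_c`. -/
theorem famR_hexagon (e : ℕ → ℕ → ℕ → Z) (a b c : ℕ) :
    ∑ h ∈ Finset.range (b + 1), ∑ g ∈ Finset.range (a + 1),
      (coeffR b c h * coeffR a (c + h) g) • e (c + h + g) (a - g) (b - h) =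
    ∑ H ∈ Finset.range (a + b + 1), coeffHex (a + b) c H •
      (famDE ^ H) (e (c + H)) a b := by
  simp only [famDE_pow, Finset.sum_apply, Finset.smul_sum, Pi.smul_apply]
  have : ∀ H ∈ Finset.range (a + b + 1), ∑ p ∈ Finset.HasAntidiagonal.antidiagonal H, coeffHex (a + b) c H •
      (qPow (p.1 * p.2) * qBinom H p.1) • (famEK ^ p.1) ((famE ^ p.2) (e (c + H))) a b =
      ∑ p ∈ Finset.HasAntidiagonal.antidiagonal H, coeffHex (a + b) c (p.1 + p.2) •
      (qPow (p.1 * p.2) * qBinom (p.1 + p.2) p.1) •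
        (famEK ^ p.1) ((famE ^ p.2) (e (c + (p.1 + p.2)))) a b := by
    intro H _
    refine Finset.sum_congr rfl fun p hp => ?_
    rw [Finset.HasAntidiagonal.mem_antidiagonal] at hp
    rw [hp]
  rw [Finset.sum_congr rfl this, sum_range_antidiagonal]
  · refine Finset.sum_congr rfl fun h hh => Finset.sum_congr rfl fun g hg => ?_
    rw [Finset.mem_range] at hh hg
    rw [famEK_pow_apply, if_pos (by omega), famE_pow_apply, if_pos (by omega), smul_smul, smul_smul,
      coeffR_mul_coeffR, add_assoc c h g, add_comm h g, ← mul_assoc, ← mul_assoc]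
  · intro p hp
    rw [famEK_pow_apply, famE_pow_apply]
    split_ifs <;> simp_all

theorem famR_comm_pow (H : ℕ) (f : ℕ → ℕ → Z) :
    famR ((famDE ^ H) f) = (famDE ^ H) (famR f) := by
  induction H with
  | zero => rfl
  | succ H ih => rw [pow_succ', Module.End.mul_apply, Module.End.mul_apply, famR_comm, ih]

/-- The `R`-matrix in the first two places of a family. -/
def famR₁ (e : ℕ → ℕ → ℕ → Z) (a b c : ℕ) : Z :=
  ∑ h ∈ Finset.range (a + 1), coeffR a b h • e (b + h) (a - h) c

/-- The `R`-matrix in the last two places of a family. -/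
def famR₂ (e : ℕ → ℕ → ℕ → Z) (a b c : ℕ) : Z :=
  ∑ h ∈ Finset.range (b + 1), coeffR b c h • e a (c + h) (b - h)

theorem famR₂_famR₁ (e : ℕ → ℕ → ℕ → Z) (a b c : ℕ) :
    famR₂ (famR₁ e) a b c = ∑ H ∈ Finset.range (a + b + 1), coeffHex (a + b) c H •
      (famDE ^ H) (e (c + H)) a b := by
  rw [← famR_hexagon]
  simp only [famR₂, famR₁, Finset.smul_sum, mul_smul]

/-- The braid relation for the `R`-matrix. -/
theorem famR_braid (e : ℕ → ℕ → ℕ → Z) :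
    famR₁ (famR₂ (famR₁ e)) = famR₂ (famR₁ (famR₂ e)) := by
  funext a b c
  rw [famR₂_famR₁, famR₁]
  have h1 : ∀ h ∈ Finset.range (a + 1), coeffR a b h • famR₂ (famR₁ e) (b + h) (a - h) c =
      ∑ H ∈ Finset.range (a + b + 1), coeffHex (a + b) c H • coeffR a b h •
      (famDE ^ H) (e (c + H)) (b + h) (a - h) := by
    intro h hh
    rw [Finset.mem_range] at hh
    rw [famR₂_famR₁, show b + h + (a - h) = a + b by omega, Finset.smul_sum]
    simp only [smul_comm (coeffR a b h)]
  rw [Finset.sum_congr rfl h1, Finset.sum_comm]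
  refine Finset.sum_congr rfl fun H _ => ?_
  rw [← Finset.smul_sum]
  congr 1
  exact congrFun (congrFun (famR_comm_pow H (e (c + H))) a) b

end Families

/-! ### The operators on the standard basis of the tensor powers -/

theorem opK_v (a : ℕ) : opK (v a) = kap a • v a := by
  rw [opK, Module.Basis.constr_basis]; rfl

theorem opE_v (a : ℕ) : opE (v a) = (if a = 0 then (0 : LRing) else 1) • v (a - 1) := by
  rw [opE, Module.Basis.constr_basis]; split_ifs <;> simp

theorem vermaPowBasis_apply {n : ℕ} (α : Fin n → ℕ) :
    vermaPowBasis n α = PiTensorProduct.tprod LRing fun k => v (α k) := by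
  simp [vermaPowBasis, Basis.piTensorProduct_apply]

theorem powK_basis {n : ℕ} (α : Fin n → ℕ) :
    powK n (vermaPowBasis n α) = (∏ k, kap (α k)) • vermaPowBasis n α := by
  rw [vermaPowBasis_apply, powK, PiTensorProduct.map_tprod]
  simp only [opK_v]
  exact MultilinearMap.map_smul_univ _ _ _

theorem prod_kap {n : ℕ} (α : Fin n → ℕ) :
    ∏ k, kap (α k) = mono n (-2 * ((∑ k, α k : ℕ) : ℤ)) := by
  have (s : Finset (Fin n)) : ∏ k ∈ s, kap (α k) = mono s.card (-2 * ((∑ k ∈ s, α k : ℕ) : ℤ)) := by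
    induction s using Finset.induction_on with
    | empty => simp [mono_zero]
    | insert a s ha ih =>
      rw [Finset.prod_insert ha, ih, kap, mono_mul, Finset.card_insert_of_notMem ha,
        Finset.sum_insert ha]
      push_cast; congr 1 <;> ring
  simpa using this Finset.univ

/-- The summand of the action of `E` on `V ^ {⊗ n}` with `E` in position `j`. -/
def powEAt (n : ℕ) (j : Fin n) : VermaPow n →ₗ[LRing] VermaPow n :=
  PiTensorProduct.map fun k => if k < j then LinearMap.id else if k = j then opE else opK

theorem powE_eq_sum (n : ℕ) : powE n = ∑ j, powEAt n j := rfl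

/-- The scalar by which the factor in position `k` of the `j`-th summand of `E` acts on `v_a`. -/
def wtE {n : ℕ} (j k : Fin n) (a : ℕ) : LRing :=
  if k < j then 1 else if k = j then (if a = 0 then 0 else 1) else kap a

theorem powEAt_basis {n : ℕ} (j : Fin n) (α : Fin n → ℕ) :
    powEAt n j (vermaPowBasis n α) =
      (∏ k, wtE j k (α k)) • vermaPowBasis n (Function.update α j (α j - 1)) := by
  rw [vermaPowBasis_apply, vermaPowBasis_apply, powEAt, PiTensorProduct.map_tprod,
    ← MultilinearMap.map_smul_univ]
  congr 1
  funext k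
  rcases lt_trichotomy k j with h | rfl | h
  · simp [wtE, h, h.ne]
  · simp [wtE, opE_v]
  · simp [wtE, h.not_gt, h.ne', opK_v]

section Strands

variable {n : ℕ}

theorem leftStrand_lt_rightStrand (i : Fin (n - 1)) : leftStrand i < rightStrand i := by
  simp [leftStrand, rightStrand, Fin.lt_def]

/-- The multi-index `α` with the entries on the strands `i`, `i + 1` replaced. -/
def upd (i : Fin (n - 1)) (α : Fin n → ℕ) (x y : ℕ) : Fin n → ℕ :=
  Function.update (Function.update α (leftStrand i) x) (rightStrand i) y

theorem upd_left (i : Fin (n - 1)) (α : Fin n → ℕ) (x y : ℕ) : upd i α x y (leftStrand i) = x := by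
  simp [upd, leftStrand_ne_rightStrand i]

theorem upd_right (i : Fin (n - 1)) (α : Fin n → ℕ) (x y : ℕ) :
    upd i α x y (rightStrand i) = y := by simp [upd]

theorem upd_of_ne (i : Fin (n - 1)) (α : Fin n → ℕ) (x y : ℕ) {k : Fin n}
    (h₁ : k ≠ leftStrand i) (h₂ : k ≠ rightStrand i) : upd i α x y k = α k := by
  simp [upd, h₁, h₂]

theorem eq_upd_iff (i : Fin (n - 1)) (α β : Fin n → ℕ) (x y : ℕ) :
    β = upd i α x y ↔ β (leftStrand i) = x ∧ β (rightStrand i) = y ∧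
      ∀ k, k ≠ leftStrand i → k ≠ rightStrand i → β k = α k := by
  constructor
  · rintro rfl
    exact ⟨upd_left .., upd_right .., fun k h₁ h₂ => upd_of_ne i α x y h₁ h₂⟩
  · rintro ⟨h₁, h₂, h₃⟩
    funext k
    by_cases hk₁ : k = leftStrand i
    · rw [hk₁, upd_left, h₁]
    by_cases hk₂ : k = rightStrand i
    · rw [hk₂, upd_right, h₂]
    rw [upd_of_ne i α x y hk₁ hk₂, h₃ k hk₁ hk₂]

theorem upd_self (i : Fin (n - 1)) (α : Fin n → ℕ) :
    upd i α (α (leftStrand i)) (α (rightStrand i)) = α := by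
  symm; rw [eq_upd_iff]; simp

theorem upd_upd (i : Fin (n - 1)) (α : Fin n → ℕ) (x y x' y' : ℕ) :
    upd i (upd i α x y) x' y' = upd i α x' y' := by
  rw [eq_upd_iff]
  exact ⟨upd_left .., upd_right .., fun k h₁ h₂ => by
    rw [upd_of_ne _ _ _ _ h₁ h₂, upd_of_ne _ _ _ _ h₁ h₂]⟩

@[to_additive]
theorem prod_eq_mul_mul_prod_sdiff {M : Type*} [CommMonoid M] (i : Fin (n - 1)) (f : Fin n → M) :
    ∏ k, f k = f (leftStrand i) * f (rightStrand i) *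
      ∏ k ∈ Finset.univ \ {leftStrand i, rightStrand i}, f k := by
  rw [← Finset.prod_pair (leftStrand_ne_rightStrand i), mul_comm,
    Finset.prod_sdiff (Finset.subset_univ _)]

@[to_additive]
theorem prod_upd {M : Type*} [CommMonoid M] (i : Fin (n - 1)) (f : Fin n → ℕ → M)
    (α : Fin n → ℕ) (x y : ℕ) :
    ∏ k, f k (upd i α x y k) = f (leftStrand i) x * f (rightStrand i) y *
      ∏ k ∈ Finset.univ \ {leftStrand i, rightStrand i}, f k (α k) := by
  rw [prod_eq_mul_mul_prod_sdiff i, upd_left, upd_right]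
  congr 1
  refine Finset.prod_congr rfl fun k hk => ?_
  simp only [Finset.mem_sdiff, Finset.mem_univ, Finset.mem_insert, Finset.mem_singleton, true_and,
    not_or] at hk
  rw [upd_of_ne _ _ _ _ hk.1 hk.2]

/-- The family of basis vectors which differ from `α` only on the strands `i`, `i + 1`. -/
def strandFam (i : Fin (n - 1)) (α : Fin n → ℕ) (x y : ℕ) : VermaPow n :=
  vermaPowBasis n (upd i α x y)

theorem strandFam_self (i : Fin (n - 1)) (α : Fin n → ℕ) :
    strandFam i α (α (leftStrand i)) (α (rightStrand i)) = vermaPowBasis n α := by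
  rw [strandFam, upd_self]

theorem braidOp_basis (i : Fin (n - 1)) (α : Fin n → ℕ) :
    braidOp n i (vermaPowBasis n α) =
      famR (strandFam i α) (α (leftStrand i)) (α (rightStrand i)) := by
  rw [braidOp, Module.Basis.constr_basis, opR, ← Module.Basis.tensorProduct_apply,
    Module.Basis.constr_basis, map_sum, famR_apply]
  refine Finset.sum_congr rfl fun h _ => ?_
  rw [map_smul, strandFam, vermaPowBasis_apply]
  congr 1
  refine congrArg (PiTensorProduct.tprod LRing) ?_
  funext k
  simp only [upd, Function.update_apply]
  split_ifs <;> rfl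

theorem braidOp_strandFam (i : Fin (n - 1)) (α : Fin n → ℕ) (x y : ℕ) :
    braidOp n i (strandFam i α x y) = famR (strandFam i α) x y := by
  rw [strandFam, braidOp_basis, upd_left, upd_right]
  have : strandFam i (upd i α x y) = strandFam i α := by
    funext x' y'; rw [strandFam, upd_upd, strandFam]
  rw [this]

end Strands

section Maps

variable {Z Z' : Type*} [AddCommGroup Z] [Module LRing Z] [AddCommGroup Z'] [Module LRing Z']

theorem map_famR (g : Z →ₗ[LRing] Z') (f : ℕ → ℕ → Z) (a b : ℕ) :
    g (famR f a b) = famR (fun a b => g (f a b)) a b := by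
  simp [famR_apply]

theorem map_famDE (g : Z →ₗ[LRing] Z') (f : ℕ → ℕ → Z) (a b : ℕ) :
    g (famDE f a b) = famDE (fun a b => g (f a b)) a b := by
  simp only [famDE_apply, Pi.add_apply, map_add]
  cases a <;> cases b <;> simp [famEK_zero, famEK_succ, famE_zero, famE_succ]

end Maps

section Commutation

variable {n : ℕ} (i : Fin (n - 1))

theorem powEAt_strandFam_of_ne {j : Fin n} (h₁ : j ≠ leftStrand i) (h₂ : j ≠ rightStrand i)
    (α : Fin n → ℕ) (x y : ℕ) : powEAt n j (strandFam i α x y) =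
      ((wtE j (leftStrand i) x * wtE j (rightStrand i) y) *
        ∏ k ∈ Finset.univ \ {leftStrand i, rightStrand i}, wtE j k (α k)) •
        strandFam i (Function.update α j (α j - 1)) x y := by
  rw [strandFam, powEAt_basis, strandFam, prod_upd i (wtE j), upd_of_ne _ _ _ _ h₁ h₂]
  congr 2
  rw [eq_upd_iff]
  refine ⟨?_, ?_, fun k hk₁ hk₂ => ?_⟩
  · rw [Function.update_of_ne h₁.symm, upd_left]
  · rw [Function.update_of_ne h₂.symm, upd_right]
  · by_cases hk : k = j
    · subst hk; simp
    · rw [Function.update_of_ne hk, Function.update_of_ne hk, upd_of_ne _ _ _ _ hk₁ hk₂]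

theorem wtE_mul_wtE {j : Fin n} (h₁ : j ≠ leftStrand i) (h₂ : j ≠ rightStrand i) {x y x' y' : ℕ}
    (h : x + y = x' + y') : wtE j (leftStrand i) x * wtE j (rightStrand i) y =
      wtE j (leftStrand i) x' * wtE j (rightStrand i) y' := by
  have hlt := leftStrand_lt_rightStrand i
  have hval : (rightStrand i : ℕ) = leftStrand i + 1 := rfl
  rcases lt_or_gt_of_ne h₁ with h3 | h3
  · have h4 : j < rightStrand i := h3.trans hlt
    simp only [wtE, h3.not_gt, h4.not_gt, h₁.symm, h₂.symm, if_false, kap, mono_mul]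
    congr 1
    have : (x : ℤ) + y = x' + y' := by exact_mod_cast h
    linarith
  · have h4 : rightStrand i < j := by
      rw [Fin.lt_def] at h3 ⊢
      have : (j : ℕ) ≠ rightStrand i := fun h => h₂ (Fin.ext h)
      omega
    simp [wtE, h3, h4]

theorem braidOp_powEAt_of_ne {j : Fin n} (h₁ : j ≠ leftStrand i) (h₂ : j ≠ rightStrand i)
    (α : Fin n → ℕ) : braidOp n i (powEAt n j (vermaPowBasis n α)) =
      powEAt n j (braidOp n i (vermaPowBasis n α)) := by
  rw [← strandFam_self i α, powEAt_strandFam_of_ne i h₁ h₂, map_smul, braidOp_strandFam,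
    braidOp_strandFam, map_famR, famR_apply, famR_apply, Finset.smul_sum]
  refine Finset.sum_congr rfl fun h hh => ?_
  rw [Finset.mem_range] at hh
  rw [powEAt_strandFam_of_ne i h₁ h₂, smul_comm,
    wtE_mul_wtE i h₁ h₂ (x' := α (rightStrand i) + h) (y' := α (leftStrand i) - h) (by omega)]

/-- The scalar by which the strands other than `i`, `i + 1` contribute to the summands of `E` in
these positions. -/
def restWt (α : Fin n → ℕ) : LRing :=
  ∏ k ∈ Finset.univ \ {leftStrand i, rightStrand i}, wtE (leftStrand i) k (α k)

theorem powEAt_left_strandFam (α : Fin n → ℕ) (x y : ℕ) :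
    powEAt n (leftStrand i) (strandFam i α x y) = restWt i α • famEK (strandFam i α) x y := by
  have hlt := leftStrand_lt_rightStrand i
  have u1 : Function.update (upd i α x y) (leftStrand i) (x - 1) = upd i α (x - 1) y := by
    rw [eq_upd_iff]
    refine ⟨by simp, by rw [Function.update_of_ne hlt.ne', upd_right], fun k h₁ h₂ => ?_⟩
    rw [Function.update_of_ne h₁, upd_of_ne _ _ _ _ h₁ h₂]
  rw [strandFam, powEAt_basis, prod_upd i (wtE (leftStrand i)), upd_left, u1, ← restWt]
  have w1 : wtE (leftStrand i) (rightStrand i) y = kap y := by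
    rw [wtE, if_neg hlt.not_gt, if_neg hlt.ne']
  have w2 : wtE (leftStrand i) (leftStrand i) x = if x = 0 then 0 else 1 := by
    rw [wtE, if_neg (lt_irrefl _), if_pos rfl]
  rw [w1, w2]
  cases x with
  | zero => rw [famEK_zero, if_pos rfl, zero_mul, zero_mul, zero_smul, smul_zero]
  | succ x =>
    rw [famEK_succ, smul_smul, if_neg (Nat.succ_ne_zero x), one_mul, mul_comm]
    rfl

theorem powEAt_right_strandFam (α : Fin n → ℕ) (x y : ℕ) :
    powEAt n (rightStrand i) (strandFam i α x y) = restWt i α • famE (strandFam i α) x y := by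
  have hlt := leftStrand_lt_rightStrand i
  have hval : (rightStrand i : ℕ) = leftStrand i + 1 := rfl
  have hprod : ∏ k ∈ Finset.univ \ {leftStrand i, rightStrand i}, wtE (rightStrand i) k (α k) =
      restWt i α := by
    refine Finset.prod_congr rfl fun k hk => ?_
    simp only [Finset.mem_sdiff, Finset.mem_univ, Finset.mem_insert, Finset.mem_singleton, true_and,
      not_or] at hk
    have h3 : k < rightStrand i ↔ k < leftStrand i := by
      have : (k : ℕ) ≠ leftStrand i := fun h => hk.1 (Fin.ext h)
      rw [Fin.lt_def, Fin.lt_def]; omega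
    simp only [wtE, h3, hk.1, hk.2]
  have u2 : Function.update (upd i α x y) (rightStrand i) (y - 1) = upd i α x (y - 1) := by
    rw [eq_upd_iff]
    refine ⟨by rw [Function.update_of_ne hlt.ne, upd_left], by simp, fun k h₁ h₂ => ?_⟩
    rw [Function.update_of_ne h₂, upd_of_ne _ _ _ _ h₁ h₂]
  rw [strandFam, powEAt_basis, prod_upd i (wtE (rightStrand i)), upd_right, u2, hprod]
  have w1 : wtE (rightStrand i) (leftStrand i) x = 1 := by rw [wtE, if_pos hlt]
  have w2 : wtE (rightStrand i) (rightStrand i) y = if y = 0 then 0 else 1 := by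
    rw [wtE, if_neg (lt_irrefl _), if_pos rfl]
  rw [w1, w2, one_mul]
  cases y with
  | zero => rw [famE_zero, if_pos rfl, zero_mul, zero_smul, smul_zero]
  | succ y =>
    rw [famE_succ, if_neg (Nat.succ_ne_zero y), one_mul]
    rfl

theorem powEAt_add_strandFam (α : Fin n → ℕ) (x y : ℕ) :
    (powEAt n (leftStrand i) + powEAt n (rightStrand i)) (strandFam i α x y) =
      restWt i α • famDE (strandFam i α) x y := by
  rw [LinearMap.add_apply, powEAt_left_strandFam, powEAt_right_strandFam, ← smul_add]
  rfl

/-- The braid generators commute with the action of `E`. -/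
theorem braidOp_powE (x : VermaPow n) : braidOp n i (powE n x) = powE n (braidOp n i x) := by
  have : braidOp n i ∘ₗ powE n = powE n ∘ₗ braidOp n i := by
    refine (vermaPowBasis n).ext fun α => ?_
    simp only [LinearMap.comp_apply]
    have hs : powE n = (powEAt n (leftStrand i) + powEAt n (rightStrand i)) +
        ∑ k ∈ Finset.univ \ {leftStrand i, rightStrand i}, powEAt n k := by
      rw [powE_eq_sum, sum_eq_add_add_sum_sdiff i]
    rw [hs, LinearMap.add_apply _ (∑ k ∈ _, _), LinearMap.add_apply _ (∑ k ∈ _, _), map_add]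
    refine congrArg₂ (· + ·) ?_ ?_
    · rw [← strandFam_self i α, powEAt_add_strandFam, map_smul, map_famDE, braidOp_strandFam,
        map_famR]
      simp only [powEAt_add_strandFam, braidOp_strandFam]
      have h1 := congrFun (congrFun (famR_comm (strandFam i α)) (α (leftStrand i)))
        (α (rightStrand i))
      rw [show (fun a b => famR (strandFam i α) a b) = famR (strandFam i α) from rfl, ← h1,
        ← Pi.smul_apply, ← Pi.smul_apply, ← map_smul]
      rfl
    · simp only [LinearMap.sum_apply, map_sum]
      refine Finset.sum_congr rfl fun k hk => ?_
      simp only [Finset.mem_sdiff, Finset.mem_univ, Finset.mem_insert, Finset.mem_singleton,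
        true_and, not_or] at hk
      exact braidOp_powEAt_of_ne i hk.1 hk.2 α
  exact LinearMap.congr_fun this x

end Commutation

/-! ### The braid relations -/

section Braid

variable {n : ℕ}

theorem map_famR₁ {Z Z' : Type*} [AddCommGroup Z] [Module LRing Z] [AddCommGroup Z']
    [Module LRing Z'] (g : Z →ₗ[LRing] Z') (f : ℕ → ℕ → ℕ → Z) (a b c : ℕ) :
    g (famR₁ f a b c) = famR₁ (fun a b c => g (f a b c)) a b c := by
  simp [famR₁]

theorem map_famR₂ {Z Z' : Type*} [AddCommGroup Z] [Module LRing Z] [AddCommGroup Z']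
    [Module LRing Z'] (g : Z →ₗ[LRing] Z') (f : ℕ → ℕ → ℕ → Z) (a b c : ℕ) :
    g (famR₂ f a b c) = famR₂ (fun a b c => g (f a b c)) a b c := by
  simp [famR₂]

theorem braidOp_braid (i j : Fin (n - 1)) (hij : (i : ℕ) + 1 = j) (x : VermaPow n) :
    braidOp n i (braidOp n j (braidOp n i x)) = braidOp n j (braidOp n i (braidOp n j x)) := by
  have hPQ : leftStrand i ≠ rightStrand i := leftStrand_ne_rightStrand i
  have hj : leftStrand j = rightStrand i := by simp [leftStrand, rightStrand, hij]
  have hQS : rightStrand i ≠ rightStrand j := hj ▸ leftStrand_ne_rightStrand j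
  have hPS : leftStrand i ≠ rightStrand j := by
    simp only [leftStrand, rightStrand, ne_eq, Fin.mk.injEq]; omega
  have key : braidOp n i ∘ₗ braidOp n j ∘ₗ braidOp n i =
      braidOp n j ∘ₗ braidOp n i ∘ₗ braidOp n j := by
    refine (vermaPowBasis n).ext fun α => ?_
    let e (a b c : ℕ) : VermaPow n :=
      vermaPowBasis n (Function.update (upd i α a b) (rightStrand j) c)
    have eP (a b c : ℕ) : Function.update (upd i α a b) (rightStrand j) c (leftStrand i) = a := by
      rw [Function.update_of_ne hPS, upd_left]
    have eQ (a b c : ℕ) : Function.update (upd i α a b) (rightStrand j) c (rightStrand i) = b := by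
      rw [Function.update_of_ne hQS, upd_right]
    have hi (a b c : ℕ) : braidOp n i (e a b c) = famR₁ e a b c := by
      simp only [e]
      rw [braidOp_basis, famR_apply, famR₁, eP, eQ]
      refine Finset.sum_congr rfl fun h _ => ?_
      rw [strandFam]
      congr 2
      symm
      rw [eq_upd_iff]
      refine ⟨eP .., eQ .., fun k h₁ h₂ => ?_⟩
      by_cases hk : k = rightStrand j
      · subst hk; simp
      · rw [Function.update_of_ne hk, Function.update_of_ne hk, upd_of_ne _ _ _ _ h₁ h₂,
          upd_of_ne _ _ _ _ h₁ h₂]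
    have hjj (a b c : ℕ) : braidOp n j (e a b c) = famR₂ e a b c := by
      simp only [e]
      rw [braidOp_basis, famR_apply, famR₂, hj, eQ, Function.update_self]
      refine Finset.sum_congr rfl fun h _ => ?_
      rw [strandFam]
      congr 2
      symm
      rw [eq_upd_iff, hj]
      refine ⟨eQ .., by simp, fun k h₁ h₂ => ?_⟩
      rw [Function.update_of_ne h₂, Function.update_of_ne h₂]
      by_cases hk : k = leftStrand i
      · rw [hk, upd_left, upd_left]
      · rw [upd_of_ne _ _ _ _ hk h₁, upd_of_ne _ _ _ _ hk h₁]
    have hα : vermaPowBasis n α =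
        e (α (leftStrand i)) (α (rightStrand i)) (α (rightStrand j)) := by
      simp only [e, upd_self, Function.update_eq_self]
    simp only [LinearMap.comp_apply, hα, hi, hjj, map_famR₁, map_famR₂]
    exact congrFun (congrFun (congrFun (famR_braid e) _) _) _
  exact LinearMap.congr_fun key x

theorem braidOp_comm (i j : Fin (n - 1)) (hij : (i : ℕ) + 1 < j) (x : VermaPow n) :
    braidOp n i (braidOp n j x) = braidOp n j (braidOp n i x) := by
  have h₁ : leftStrand i ≠ leftStrand j := by
    simp only [leftStrand, ne_eq, Fin.mk.injEq]; omega
  have h₂ : leftStrand i ≠ rightStrand j := by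
    simp only [leftStrand, rightStrand, ne_eq, Fin.mk.injEq]; omega
  have h₃ : rightStrand i ≠ leftStrand j := by
    simp only [leftStrand, rightStrand, ne_eq, Fin.mk.injEq]; omega
  have h₄ : rightStrand i ≠ rightStrand j := by
    simp only [rightStrand, ne_eq, Fin.mk.injEq]; omega
  have hcomm (α : Fin n → ℕ) (a b c d : ℕ) : upd j (upd i α a b) c d = upd i (upd j α c d) a b := by
    rw [eq_upd_iff]
    refine ⟨?_, ?_, fun k hk₁ hk₂ => ?_⟩
    · rw [upd_of_ne _ _ _ _ h₁ h₂, upd_left]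
    · rw [upd_of_ne _ _ _ _ h₃ h₄, upd_right]
    · by_cases hk₃ : k = leftStrand j
      · rw [hk₃, upd_left, upd_left]
      by_cases hk₄ : k = rightStrand j
      · rw [hk₄, upd_right, upd_right]
      rw [upd_of_ne _ _ _ _ hk₃ hk₄, upd_of_ne _ _ _ _ hk₃ hk₄, upd_of_ne _ _ _ _ hk₁ hk₂]
  have key : braidOp n i ∘ₗ braidOp n j = braidOp n j ∘ₗ braidOp n i := by
    refine (vermaPowBasis n).ext fun α => ?_
    simp only [LinearMap.comp_apply, braidOp_basis, map_famR]
    simp only [famR_apply, strandFam, braidOp_basis, upd_of_ne j _ _ _ h₁ h₂,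
      upd_of_ne j _ _ _ h₃ h₄, upd_of_ne i _ _ _ h₁.symm h₃.symm, upd_of_ne i _ _ _ h₂.symm h₄.symm,
      Finset.smul_sum, hcomm]
    rw [Finset.sum_comm]
    simp only [smul_comm (coeffR (α (leftStrand j)) _ _)]
  exact LinearMap.congr_fun key x

/-! ### Invertibility -/

theorem sum_upd_eq (i : Fin (n - 1)) (α : Fin n → ℕ) {x y : ℕ}
    (h : x + y = α (leftStrand i) + α (rightStrand i)) : ∑ k, upd i α x y k = ∑ k, α k := by
  have := sum_upd i (fun _ => id) α x y
  simp only [id] at this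
  rw [this, sum_eq_add_add_sum_sdiff i α, h]

theorem braidOp_surjective (i : Fin (n - 1)) (l : ℕ) (α : Fin n → ℕ) (hα : ∑ k, α k = l) :
    ∃ x ∈ Submodule.span LRing (vermaPowBasis n '' {β | ∑ k, β k = l}),
      braidOp n i x = vermaPowBasis n α := by
  induction hm : α (rightStrand i) using Nat.strong_induction_on generalizing α with
  | _ m ih =>
    subst hm
    have hsum (x y : ℕ) (h : x + y = α (leftStrand i) + α (rightStrand i)) :
        ∑ k, upd i α x y k = l := by
      rw [sum_upd_eq i α h, hα]
    have hb (h : ℕ) : h ∈ Finset.range (α (rightStrand i)) → ∃ x ∈ Submodule.span LRing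
        (vermaPowBasis n '' {β | ∑ k, β k = l}), braidOp n i x =
          strandFam i α (α (leftStrand i) + (h + 1)) (α (rightStrand i) - (h + 1)) := by
      intro hh
      rw [Finset.mem_range] at hh
      refine ih (α (rightStrand i) - (h + 1)) (by omega) _ (hsum _ _ (by omega)) (upd_right ..)
    choose! x hx hRx using hb
    have hfam : braidOp n i (strandFam i α (α (rightStrand i)) (α (leftStrand i))) =
        ∑ h ∈ Finset.range (α (rightStrand i)),
          coeffR (α (rightStrand i)) (α (leftStrand i)) (h + 1) • braidOp n i (x h) +
        coeffR (α (rightStrand i)) (α (leftStrand i)) 0 • vermaPowBasis n α := by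
      rw [braidOp_strandFam, famR_apply, Finset.sum_range_succ', Nat.add_zero, Nat.sub_zero,
        strandFam_self]
      congr 1
      exact Finset.sum_congr rfl fun h hh => by rw [hRx h hh]
    have hu : IsUnit (coeffR (α (rightStrand i)) (α (leftStrand i)) 0) := by
      rw [coeffR_zero_right]; exact isUnit_mono _ _
    obtain ⟨u, hu⟩ := hu
    refine ⟨(↑u⁻¹ : LRing) • (strandFam i α (α (rightStrand i)) (α (leftStrand i)) -
      ∑ h ∈ Finset.range (α (rightStrand i)),
          coeffR (α (rightStrand i)) (α (leftStrand i)) (h + 1) • x h), ?_, ?_⟩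
    · refine Submodule.smul_mem _ _ (Submodule.sub_mem _ (Submodule.subset_span ⟨_, hsum _ _ ?_, rfl⟩)
        (Submodule.sum_mem _ fun h hh => Submodule.smul_mem _ _ (hx h hh)))
      exact add_comm _ _
    · rw [map_smul, map_sub, hfam, map_sum]
      simp only [map_smul, add_sub_cancel_left, ← hu, smul_smul, Units.inv_mul, one_smul]

theorem repr_braidOp_eq_zero (i : Fin (n - 1)) {α β : Fin n → ℕ}
    (hle : β (leftStrand i) ≤ α (leftStrand i)) (hne : β ≠ α) :
    (vermaPowBasis n).repr (braidOp n i (vermaPowBasis n β))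
      (upd i α (α (rightStrand i)) (α (leftStrand i))) = 0 := by
  rw [braidOp_basis, famR_apply, map_sum, Finset.sum_apply']
  refine Finset.sum_eq_zero fun h hh => ?_
  rw [strandFam, map_smul, Module.Basis.repr_self, Finsupp.smul_apply, Finsupp.single_apply,
    if_neg, smul_zero]
  intro heq
  rw [eq_upd_iff, upd_left, upd_right] at heq
  obtain ⟨h₁, h₂, h₃⟩ := heq
  rw [Finset.mem_range] at hh
  refine hne ?_
  rw [← upd_self i α, eq_upd_iff]
  refine ⟨by omega, by omega, fun k hk₁ hk₂ => ?_⟩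
  rw [← h₃ k hk₁ hk₂, upd_of_ne _ _ _ _ hk₁ hk₂]

theorem repr_braidOp_self (i : Fin (n - 1)) (α : Fin n → ℕ) :
    (vermaPowBasis n).repr (braidOp n i (vermaPowBasis n α))
      (upd i α (α (rightStrand i)) (α (leftStrand i))) =
        coeffR (α (leftStrand i)) (α (rightStrand i)) 0 := by
  rw [braidOp_basis, famR_apply, map_sum, Finset.sum_apply', Finset.sum_eq_single 0]
  · simp [strandFam]
  · intro h _ hh
    rw [strandFam, map_smul, Module.Basis.repr_self, Finsupp.smul_apply, Finsupp.single_apply,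
      if_neg, smul_zero]
    intro heq
    have := congrFun heq (leftStrand i)
    rw [upd_left, upd_left] at this
    omega
  · simp

theorem braidOp_injective (i : Fin (n - 1)) : Function.Injective (braidOp n i) := by
  rw [injective_iff_map_eq_zero]
  intro x hx
  by_contra hne
  set c := (vermaPowBasis n).repr x with hc
  have hs : c.support.Nonempty := by
    rw [Finsupp.support_nonempty_iff, hc]
    simpa using hne
  obtain ⟨α, hα, hmax⟩ := c.support.exists_max_image (fun α => α (leftStrand i)) hs
  have hx' : x = ∑ β ∈ c.support, c β • vermaPowBasis n β := by
    conv_lhs => rw [← (vermaPowBasis n).linearCombination_repr x]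
    rfl
  have h0 : (vermaPowBasis n).repr (braidOp n i x)
      (upd i α (α (rightStrand i)) (α (leftStrand i))) = (vermaPowBasis n).repr 0
      (upd i α (α (rightStrand i)) (α (leftStrand i))) := by rw [hx]
  rw [hx', map_sum, map_sum, Finset.sum_apply', Finset.sum_eq_single α] at h0
  · rw [map_smul, map_smul, Finsupp.smul_apply, repr_braidOp_self, coeffR_zero_right, map_zero,
      Finsupp.zero_apply, smul_eq_mul] at h0
    exact (Finsupp.mem_support_iff.mp hα) ((mul_eq_zero.mp h0).resolve_right (mono_ne_zero _ _))
  · intro β hβ hne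
    rw [map_smul, map_smul, Finsupp.smul_apply, repr_braidOp_eq_zero i (hmax β hβ) hne, smul_zero]
  · exact fun h => absurd hα h

/-! ### Weight spaces -/

theorem mem_weightSpace_iff (l : ℕ) (x : VermaPow n) : x ∈ weightSpace n l ↔
    ∀ α, (vermaPowBasis n).repr x α ≠ 0 → ∑ k, α k = l := by
  have hrepr (α : Fin n → ℕ) : (vermaPowBasis n).repr (powK n x) α =
      (∏ k, kap (α k)) * (vermaPowBasis n).repr x α := by
    have : (vermaPowBasis n).coord α ∘ₗ powK n = (∏ k, kap (α k)) • (vermaPowBasis n).coord α := by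
      refine (vermaPowBasis n).ext fun β => ?_
      simp only [LinearMap.comp_apply, powK_basis, map_smul, LinearMap.smul_apply,
        Module.Basis.coord_apply, Module.Basis.repr_self, Finsupp.single_apply]
      split_ifs with h
      · rw [h]
      · simp
    exact LinearMap.congr_fun this x
  rw [weightSpace, LinearMap.mem_ker, ← (vermaPowBasis n).repr.map_eq_zero_iff, Finsupp.ext_iff]
  refine forall_congr' fun α => ?_
  rw [LinearMap.sub_apply, map_sub, Finsupp.sub_apply, hrepr, LinearMap.smul_apply,
    LinearMap.id_apply, map_smul, Finsupp.smul_apply, smul_eq_mul, ← sub_mul, Finsupp.zero_apply,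
    mul_eq_zero, or_iff_not_imp_right, prod_kap]
  refine imp_congr_right fun _ => ?_
  change mono _ _ - mono _ _ = 0 ↔ _
  rw [sub_eq_zero]
  constructor
  · intro h
    have := (isUnit_mono n 0).mul_left_cancel (b := qPow (-2 * ((∑ k, α k : ℕ) : ℤ)))
      (c := qPow (-2 * (l : ℤ))) (by simpa only [qPow_eq_mono, mono_mul, add_zero, zero_add] using h)
    have := qPow_injective this
    omega
  · rintro rfl; rfl

theorem weightSpace_eq_span (l : ℕ) : weightSpace n l =
    Submodule.span LRing (vermaPowBasis n '' {β | ∑ k, β k = l}) := by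
  ext x
  rw [mem_weightSpace_iff, Module.Basis.mem_span_image]
  simp only [Set.subset_def, Finset.mem_coe, Finsupp.mem_support_iff, Set.mem_ofPred_eq]

theorem braidOp_mem_weightSpace (i : Fin (n - 1)) (l : ℕ) {x : VermaPow n}
    (hx : x ∈ weightSpace n l) : braidOp n i x ∈ weightSpace n l := by
  rw [weightSpace_eq_span] at hx ⊢
  induction hx using Submodule.span_induction with
  | mem x hx =>
    obtain ⟨α, hα, rfl⟩ := hx
    rw [braidOp_basis, famR_apply]
    refine Submodule.sum_mem _ fun h hh => Submodule.smul_mem _ _ (Submodule.subset_span ⟨_, ?_, rfl⟩)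
    rw [Finset.mem_range] at hh
    exact (sum_upd_eq i α (by omega)).trans hα
  | zero => rw [map_zero]; exact Submodule.zero_mem _
  | add x y _ _ hx hy => rw [map_add]; exact Submodule.add_mem _ hx hy
  | smul c x _ hx => rw [map_smul]; exact Submodule.smul_mem _ _ hx

theorem exists_mem_weightSpace_braidOp_eq (i : Fin (n - 1)) (l : ℕ) {x : VermaPow n}
    (hx : x ∈ weightSpace n l) : ∃ y ∈ weightSpace n l, braidOp n i y = x := by
  rw [weightSpace_eq_span] at hx ⊢
  have : Submodule.span LRing (vermaPowBasis n '' {β | ∑ k, β k = l}) ≤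
      (Submodule.span LRing (vermaPowBasis n '' {β | ∑ k, β k = l})).map (braidOp n i) := by
    rw [Submodule.span_le]
    rintro _ ⟨α, hα, rfl⟩
    obtain ⟨y, hy, h⟩ := braidOp_surjective i l α hα
    exact ⟨y, hy, h⟩
  obtain ⟨y, hy, h⟩ := this hx
  exact ⟨y, hy, h⟩

/-- The action of a braid generator on the highest weight space. -/
def braidEquiv (l : ℕ) (i : Fin (n - 1)) :
    highestWeightSpace n l ≃ₗ[LRing] highestWeightSpace n l :=
  LinearEquiv.ofBijective
    ((braidOp n i).restrict (p := highestWeightSpace n l) (q := highestWeightSpace n l) fun x hx =>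
      ⟨(braidOp_powE i x).symm.trans ((congrArg _ (LinearMap.mem_ker.mp hx.1)).trans (map_zero _)),
        braidOp_mem_weightSpace i l hx.2⟩) (by
    constructor
    · intro x y h
      exact Subtype.ext (braidOp_injective i (congrArg Subtype.val h))
    · rintro ⟨x, hx⟩
      obtain ⟨y, hy, rfl⟩ := exists_mem_weightSpace_braidOp_eq i l hx.2
      refine ⟨⟨y, ?_, hy⟩, rfl⟩
      change powE n y = 0
      apply braidOp_injective i
      rw [braidOp_powE, map_zero]
      exact LinearMap.mem_ker.mp hx.1)

theorem lift_braidEquiv (n l : ℕ) :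
    ∀ r ∈ braidRels n, FreeGroup.lift (braidEquiv (n := n) l) r = 1 := by
  rintro r (⟨i, j, hij, rfl⟩ | ⟨i, j, hij, rfl⟩)
  · simp only [map_mul, map_inv, FreeGroup.lift_apply_of, mul_inv_eq_one]
    ext w
    exact braidOp_braid i j hij w
  · simp only [map_mul, map_inv, FreeGroup.lift_apply_of, mul_inv_eq_one]
    ext w
    exact braidOp_comm i j hij w

/-- The representation of the braid group on the highest weight space. -/
def braidRep (n l : ℕ) : Representation LRing (BraidGroup n) (highestWeightSpace n l) :=
  (LinearEquiv.automorphismGroup.toLinearMapMonoidHom).comp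
    (PresentedGroup.toGroup (lift_braidEquiv n l))

theorem braidRep_braidGen (l : ℕ) (i : Fin (n - 1)) (w : highestWeightSpace n l) :
    (braidRep n l (braidGen i) w : VermaPow n) = braidOp n i w := by
  have : PresentedGroup.toGroup (lift_braidEquiv n l) (braidGen i) = braidEquiv l i :=
    PresentedGroup.toGroup.of _
  rw [braidRep, MonoidHom.comp_apply, this]
  rfl

end Braid

/-! ### Polynomials under pseudo-reflections -/

section Reflections

open MvPolynomial

variable {K : Type*} [Field K]

/-- If `T` and `D` are simultaneously diagonalizable and the eigenvalue of `D` is determined by that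
of `T`, then `T`-stable subspaces are `D`-stable. -/
theorem apply_mem_of_mem_span_eigenvectors {V : Type*} [AddCommGroup V] [Module K V]
    (T D : Module.End K V) (t d : ℕ → K) (ht : Function.Injective t) (N : Submodule K V)
    (hN : ∀ f ∈ N, T f ∈ N) {f : V} (hf : f ∈ N)
    (hspan : f ∈ Submodule.span K {g | ∃ k, T g = t k • g ∧ D g = d k • g}) : D f ∈ N := by
  have key : ∃ M : ℕ, ∀ p : Polynomial K, (∀ k < M, p.eval (t k) = d k) →
      Polynomial.aeval T p f = D f := by
    clear hf
    induction hspan using Submodule.span_induction with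
    | mem g hg =>
      obtain ⟨k, h₁, h₂⟩ := hg
      refine ⟨k + 1, fun p hp => ?_⟩
      rw [h₂, ← hp k (Nat.lt_succ_self k)]
      have := Module.End.aeval_apply_of_hasEigenvector (f := T) (p := p) (μ := t k) (x := g)
      by_cases h0 : g = 0
      · simp [h0]
      · exact this ⟨Module.End.mem_eigenspace_iff.mpr h₁, h0⟩
    | zero => exact ⟨0, fun p _ => by simp⟩
    | add x y _ _ hx hy =>
      obtain ⟨M, hM⟩ := hx
      obtain ⟨M', hM'⟩ := hy
      refine ⟨max M M', fun p hp => ?_⟩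
      rw [map_add, map_add, hM p fun k hk => hp k (lt_max_of_lt_left hk),
        hM' p fun k hk => hp k (lt_max_of_lt_right hk)]
    | smul c x _ hx =>
      obtain ⟨M, hM⟩ := hx
      exact ⟨M, fun p hp => by rw [map_smul, map_smul, hM p hp]⟩
  obtain ⟨M, hM⟩ := key
  rw [← hM (Lagrange.interpolate (Finset.range M) t d) fun k hk =>
    Lagrange.eval_interpolate_at_node _ ht.injOn (Finset.mem_range.mpr hk)]
  generalize Lagrange.interpolate (Finset.range M) t d = p
  induction p using Polynomial.induction_on' with
  | add p q hp hq => rw [map_add]; exact N.add_mem hp hq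
  | monomial k a =>
    rw [Polynomial.aeval_monomial, Module.End.mul_apply, Module.algebraMap_end_apply]
    refine N.smul_mem _ ?_
    induction k with
    | zero => simpa using hf
    | succ k ih => rw [pow_succ', Module.End.mul_apply]; exact hN _ ih

variable {m : ℕ} (c : Fin m → Fin m → K)

/-- The pseudo-reflection `X_j ↦ X_j - c_{ij} X_i`. -/
def reflHom (i : Fin m) : MvPolynomial (Fin m) K →ₐ[K] MvPolynomial (Fin m) K :=
  aeval fun j => X j - C (c i j) * X i

/-- The derivation with constant coefficients `∑_j c_{ij} ∂_j`. -/
def dirDeriv (i : Fin m) : Derivation K (MvPolynomial (Fin m) K) (MvPolynomial (Fin m) K) :=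
  mkDerivation K fun j => C (c i j)

theorem dirDeriv_X (i j : Fin m) : dirDeriv c i (X j) = C (c i j) := mkDerivation_X ..

theorem derivation_sum_apply {ι : Type*} (s : Finset ι)
    (D : ι → Derivation K (MvPolynomial (Fin m) K) (MvPolynomial (Fin m) K))
    (f : MvPolynomial (Fin m) K) : (∑ i ∈ s, D i) f = ∑ i ∈ s, D i f := by
  classical
  induction s using Finset.induction_on with
  | empty => simp
  | insert a s ha ih => rw [Finset.sum_insert ha, Finset.sum_insert ha, Derivation.add_apply, ih]

theorem mkDerivation_C_eq_sum (a : Fin m → K) (f : MvPolynomial (Fin m) K) :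
    mkDerivation K (fun j => (C (a j) : MvPolynomial (Fin m) K)) f = ∑ j, a j • pderiv j f := by
  have : mkDerivation K (fun j => (C (a j) : MvPolynomial (Fin m) K)) = ∑ j, a j • pderiv j := by
    refine derivation_ext fun k => ?_
    rw [mkDerivation_X, derivation_sum_apply, Finset.sum_eq_single k]
    · simp [smul_eq_C_mul]
    · intro j _ hj
      simp [pderiv_X_of_ne hj.symm]
    · simp
  rw [this, derivation_sum_apply]
  rfl

theorem dirDeriv_comm (i j : Fin m) (f : MvPolynomial (Fin m) K) :
    dirDeriv c i (dirDeriv c j f) = dirDeriv c j (dirDeriv c i f) := by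
  have : ⁅dirDeriv c i, dirDeriv c j⁆ = 0 := by
    refine derivation_ext fun k => ?_
    rw [Derivation.commutator_apply, dirDeriv_X, dirDeriv_X]
    simp
  have h := Derivation.congr_fun this f
  rw [Derivation.commutator_apply, Derivation.zero_apply] at h
  exact sub_eq_zero.mp h

/-- The vector field `X_a ∑_j c_{bj} ∂_j`. -/
def vecField (a b : Fin m) : Module.End K (MvPolynomial (Fin m) K) :=
  ((X a : MvPolynomial (Fin m) K) • dirDeriv c b).toLinearMap

theorem vecField_apply (a b : Fin m) (f : MvPolynomial (Fin m) K) :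
    vecField c a b f = X a * dirDeriv c b f := rfl

theorem vecField_bracket (a b a' b' : Fin m) (f : MvPolynomial (Fin m) K) :
    vecField c a b (vecField c a' b' f) - vecField c a' b' (vecField c a b f) =
      c b a' • vecField c a b' f - c b' a • vecField c a' b f := by
  simp only [vecField_apply, Derivation.leibniz, dirDeriv_X, smul_eq_mul, smul_eq_C_mul]
  rw [dirDeriv_comm c b b']
  ring

theorem span_eigenvectors_reflHom {τ : K} (i : Fin m) (hd : c i i = 1 - τ) (hτ : τ ≠ 1)
    (f : MvPolynomial (Fin m) K) : f ∈ Submodule.span K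
      {g | ∃ k : ℕ, (reflHom c i).toLinearMap g = τ ^ k • g ∧
        vecField c i i g = ((k : K) * (1 - τ)) • g} := by
  set S := {g | ∃ k : ℕ, (reflHom c i).toLinearMap g = τ ^ k • g ∧
        vecField c i i g = ((k : K) * (1 - τ)) • g} with hS
  have h1τ : (1 - τ) ≠ 0 := sub_ne_zero.mpr hτ.symm
  have hXi : X i ∈ S := by
    refine ⟨1, ?_, ?_⟩
    · rw [AlgHom.toLinearMap_apply, reflHom, aeval_X, hd, pow_one, smul_eq_C_mul, map_sub, map_one]
      ring
    · rw [vecField_apply, dirDeriv_X, hd, smul_eq_C_mul]; push_cast; rw [one_mul, mul_comm]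
  have hZ (j : Fin m) : X j - C (c i j / (1 - τ)) * X i ∈ S := by
    refine ⟨0, ?_, ?_⟩
    · rw [AlgHom.toLinearMap_apply, map_sub, map_mul, reflHom, aeval_X, aeval_X, aeval_C, pow_zero,
        one_smul, algebraMap_eq, hd]
      have : C (c i j) = C (c i j / (1 - τ)) * (C (1 - τ) : MvPolynomial (Fin m) K) := by
        rw [← map_mul, div_mul_cancel₀ _ h1τ]
      rw [this]; ring
    · rw [vecField_apply, map_sub, Derivation.leibniz, dirDeriv_X, dirDeriv_X, hd]
      have : C (c i j) = C (c i j / (1 - τ)) * (C (1 - τ) : MvPolynomial (Fin m) K) := by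
        rw [← map_mul, div_mul_cancel₀ _ h1τ]
      rw [this]
      simp [dirDeriv]
  have hX (j : Fin m) : X j ∈ Submodule.span K S := by
    have := Submodule.add_mem _ (Submodule.subset_span (R := K) (hZ j))
      (Submodule.smul_mem _ (c i j / (1 - τ)) (Submodule.subset_span (R := K) hXi))
    rwa [smul_eq_C_mul, sub_add_cancel] at this
  have hmul : ∀ x ∈ S, ∀ y ∈ S, x * y ∈ S := by
    rintro x ⟨k, h₁, h₂⟩ y ⟨k', h₁', h₂'⟩
    refine ⟨k + k', ?_, ?_⟩
    · rw [AlgHom.toLinearMap_apply] at h₁ h₁' ⊢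
      rw [map_mul, h₁, h₁', smul_mul_smul_comm, pow_add]
    · rw [vecField_apply] at h₂ h₂' ⊢
      rw [Derivation.leibniz, mul_add, smul_eq_mul, smul_eq_mul, mul_left_comm, h₂',
        mul_left_comm (X i) y, h₂]
      simp only [smul_eq_C_mul]
      push_cast
      simp only [map_mul, map_add]
      ring
  have hSS : ∀ x ∈ Submodule.span K S, ∀ y ∈ Submodule.span K S, x * y ∈ Submodule.span K S := by
    intro x hx y hy
    have := Submodule.mul_mem_mul hx hy
    rw [Submodule.span_mul_span] at this
    refine Submodule.span_mono ?_ this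
    rintro _ ⟨x, hx, y, hy, rfl⟩
    exact hmul x hx y hy
  induction f using MvPolynomial.induction_on with
  | C a =>
    refine Submodule.subset_span ⟨0, ?_, ?_⟩
    · rw [AlgHom.toLinearMap_apply, reflHom, aeval_C]; simp
    · rw [vecField_apply]; simp [dirDeriv]
  | add p q hp hq => exact Submodule.add_mem _ hp hq
  | mul_X p j hp => exact hSS _ hp _ (hX j)

variable (N : Submodule K (MvPolynomial (Fin m) K))

theorem vecField_self_mem {τ : K} (hτ : Function.Injective fun k : ℕ => τ ^ k) (i : Fin m)
    (hd : c i i = 1 - τ) (hN : ∀ f ∈ N, reflHom c i f ∈ N) :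
    ∀ f ∈ N, vecField c i i f ∈ N := fun f hf =>
  apply_mem_of_mem_span_eigenvectors (reflHom c i).toLinearMap (vecField c i i) (fun k => τ ^ k)
    (fun k => (k : K) * (1 - τ)) hτ N hN hf
    (span_eigenvectors_reflHom c i hd (fun h => by simpa [h] using @hτ 0 1) f)

theorem vecField_adjacent_mem [CharZero K] {i j : Fin m} (hi : ∀ f ∈ N, vecField c i i f ∈ N)
    (hj : ∀ f ∈ N, vecField c j j f ∈ N) (hii : c i i ≠ 0) (hij : c i j ≠ 0)
    (hsymm : c j i = c i j) :
    (∀ f ∈ N, vecField c i j f ∈ N) ∧ (∀ f ∈ N, vecField c j i f ∈ N) := by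
  have h₁ : ∀ f ∈ N, vecField c i j f - vecField c j i f ∈ N := by
    intro f hf
    have h := vecField_bracket c i i j j f
    rw [hsymm, ← smul_sub] at h
    rw [← N.smul_mem_iff hij, ← h]
    exact N.sub_mem (hi _ (hj _ hf)) (hj _ (hi _ hf))
  have h₂ : ∀ f ∈ N, vecField c i j f + vecField c j i f ∈ N := by
    intro f hf
    rw [← N.smul_mem_iff hii]
    have e₁ := vecField_bracket c i i i j f
    have e₂ := vecField_bracket c i i j i f
    have e : c i i • (vecField c i j f + vecField c j i f) =
        vecField c i i (vecField c i j f - vecField c j i f) -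
          (vecField c i j (vecField c i i f) - vecField c j i (vecField c i i f)) +
          (c j i + c i j) • vecField c i i f := by
      rw [map_sub]
      linear_combination (norm := module) e₂ - e₁
    rw [e]
    exact N.add_mem (N.sub_mem (hi _ (h₁ _ hf)) (h₁ _ (hi _ hf))) (N.smul_mem _ (hi _ hf))
  have h2 : (2 : K) ≠ 0 := two_ne_zero
  constructor
  · intro f hf
    rw [← N.smul_mem_iff h2, two_smul]
    simpa using N.add_mem (h₁ f hf) (h₂ f hf)
  · intro f hf
    rw [← N.smul_mem_iff h2, two_smul]
    simpa using N.sub_mem (h₂ f hf) (h₁ f hf)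

theorem vecField_mem [CharZero K] {τ : K} (hτ : Function.Injective fun k : ℕ => τ ^ k)
    (hd : ∀ i, c i i = 1 - τ) (hadj : ∀ i j : Fin m, (i : ℕ) + 1 = j → c i j ≠ 0 ∧ c j i = c i j)
    (hN : ∀ i, ∀ f ∈ N, reflHom c i f ∈ N) (a b : Fin m) : ∀ f ∈ N, vecField c a b f ∈ N := by
  have hself (i : Fin m) := vecField_self_mem c N hτ i (hd i) (hN i)
  have hii (i : Fin m) : c i i ≠ 0 := by
    rw [hd, sub_ne_zero]; rintro rfl; simpa using @hτ 0 1
  have key (k : ℕ) : ∀ i j : Fin m, (i : ℕ) + k = j →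
      (∀ f ∈ N, vecField c i j f ∈ N) ∧ (∀ f ∈ N, vecField c j i f ∈ N) := by
    induction k with
    | zero =>
      intro i j h
      obtain rfl : i = j := Fin.ext (by omega)
      exact ⟨hself i, hself i⟩
    | succ k ih =>
      intro i j h
      have hlt : (i : ℕ) + k < m := by omega
      obtain ⟨h₁, h₂⟩ := ih i ⟨i + k, hlt⟩ rfl
      set p : Fin m := ⟨i + k, hlt⟩ with hp
      have hpj : (p : ℕ) + 1 = j := by simp only [hp]; omega
      obtain ⟨h₃, h₄⟩ := vecField_adjacent_mem c N (hself p) (hself j) (hii p) (hadj p j hpj).1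
        (hadj p j hpj).2
      constructor
      · intro f hf
        rw [← N.smul_mem_iff (hii p)]
        have e := vecField_bracket c i p p j f
        rw [eq_sub_iff_add_eq] at e
        rw [← e]
        exact N.add_mem (N.sub_mem (h₁ _ (h₃ _ hf)) (h₃ _ (h₁ _ hf))) (N.smul_mem _ (hself p _ hf))
      · intro f hf
        rw [← N.smul_mem_iff (hii p)]
        have e := vecField_bracket c j p p i f
        rw [eq_sub_iff_add_eq] at e
        rw [← e]
        exact N.add_mem (N.sub_mem (h₄ _ (h₂ _ hf)) (h₂ _ (h₄ _ hf))) (N.smul_mem _ (hself p _ hf))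
  intro f hf
  rcases le_total (a : ℕ) b with h | h
  · exact (key (b - a) a b (by omega)).1 f hf
  · exact (key (a - b) b a (by omega)).2 f hf

theorem X_mul_pderiv_mem (w : Fin m → Fin m → K)
    (hw : ∀ j k, ∑ i, w j i * c i k = if j = k then 1 else 0)
    (hN : ∀ a b, ∀ f ∈ N, vecField c a b f ∈ N) (a j : Fin m) :
    ∀ f ∈ N, X a * pderiv j f ∈ N := by
  intro f hf
  have : X a * pderiv j f = ∑ i, w j i • vecField c a i f := by
    have h : pderiv j f = ∑ i, w j i • dirDeriv c i f := by
      simp only [dirDeriv, mkDerivation_C_eq_sum, Finset.smul_sum, smul_smul]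
      rw [Finset.sum_comm]
      simp only [← Finset.sum_smul, hw]
      simp
    rw [h, Finset.mul_sum]
    simp only [vecField_apply, mul_smul_comm]
  rw [this]
  exact N.sum_mem fun i _ => N.smul_mem _ (hN a i f hf)

theorem coeff_X_mul_pderiv (i : Fin m) (f : MvPolynomial (Fin m) K) (e : Fin m →₀ ℕ) :
    coeff e (X i * pderiv i f) = (e i : K) * coeff e f := by
  induction f using MvPolynomial.induction_on' with
  | monomial u a =>
    rw [X_mul_pderiv_monomial, coeff_smul, coeff_monomial, nsmul_eq_mul]
    split_ifs with h
    · rw [h]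
    · simp
  | add p q hp hq => rw [map_add, mul_add, coeff_add, hp, hq, coeff_add, mul_add]

theorem exists_monomial_mem [CharZero K] (hN : ∀ i, ∀ f ∈ N, X i * pderiv i f ∈ N) (h0 : N ≠ ⊥) :
    ∃ a, monomial a (1 : K) ∈ N := by
  obtain ⟨f, hf, hf0⟩ := N.ne_bot_iff.mp h0
  induction hk : f.support.card using Nat.strong_induction_on generalizing f with
  | _ k ih =>
    obtain ⟨a, ha⟩ := (support_nonempty.mpr hf0)
    by_cases hall : ∀ b ∈ f.support, b = a
    · refine ⟨a, ?_⟩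
      have hfa : f = monomial a (coeff a f) := by
        ext e
        rw [coeff_monomial]
        split_ifs with h
        · rw [h]
        · by_contra hne
          exact h (hall e (mem_support_iff.mpr hne)).symm
      have := N.smul_mem (coeff a f)⁻¹ hf
      rw [hfa, smul_monomial, coeff_monomial, if_pos rfl, smul_eq_mul,
        inv_mul_cancel₀ (mem_support_iff.mp ha)] at this
      exact this
    · push Not at hall
      obtain ⟨b, hb, hba⟩ := hall
      obtain ⟨i, hi⟩ := DFunLike.ne_iff.mp hba
      have hg (e : Fin m →₀ ℕ) : coeff e (X i * pderiv i f - (a i : K) • f) =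
          ((e i : K) - a i) * coeff e f := by
        rw [coeff_sub, coeff_X_mul_pderiv, coeff_smul, smul_eq_mul, sub_mul]
      refine ih _ ?_ (X i * pderiv i f - (a i : K) • f) (N.sub_mem (hN i f hf) (N.smul_mem _ hf)) ?_ rfl
      · rw [← hk]
        refine Finset.card_lt_card (Finset.ssubset_iff_of_subset ?_ |>.mpr ⟨a, ha, ?_⟩)
        · intro e he
          rw [mem_support_iff, hg] at he
          exact mem_support_iff.mpr (right_ne_zero_of_mul he)
        · rw [mem_support_iff, hg, sub_self, zero_mul]; simp
      · intro h
        have := hg b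
        rw [h, coeff_zero] at this
        rcases mul_eq_zero.mp this.symm with h | h
        · exact hi (by exact_mod_cast sub_eq_zero.mp h)
        · exact mem_support_iff.mp hb h

theorem monomial_mem_of_degree_eq [CharZero K] (hN : ∀ a j, ∀ f ∈ N, X a * pderiv j f ∈ N)
    (a b e : Fin m →₀ ℕ) (hab : a.degree = b.degree) (ha : monomial (e + a) (1 : K) ∈ N) :
    monomial (e + b) (1 : K) ∈ N := by
  induction hd : a.degree generalizing a b e with
  | zero =>
    rw [hd] at hab
    rw [Finsupp.degree_eq_zero_iff] at hd
    rw [eq_comm, Finsupp.degree_eq_zero_iff] at hab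
    rwa [hab, ← hd]
  | succ d ih =>
    have hex : ∀ u : Fin m →₀ ℕ, u.degree = d + 1 →
        ∃ j u', u = u' + Finsupp.single j 1 ∧ u'.degree = d := by
      intro u hu
      have hne : u ≠ 0 := by rintro rfl; simp at hu
      obtain ⟨j, hj⟩ := DFunLike.ne_iff.mp hne
      have hle : Finsupp.single j 1 ≤ u := by
        rw [Finsupp.single_le_iff]
        exact Nat.one_le_iff_ne_zero.mpr hj
      refine ⟨j, u - Finsupp.single j 1, (tsub_add_cancel_of_le hle).symm, ?_⟩
      have h := congrArg Finsupp.degree (tsub_add_cancel_of_le hle)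
      rw [map_add, Finsupp.degree_single, hu] at h
      omega
    obtain ⟨j, a', rfl, ha'⟩ := hex a hd
    obtain ⟨i, b', rfl, hb'⟩ := hex b (hab ▸ hd)
    have hmove : monomial (e + Finsupp.single i 1 + a') (1 : K) ∈ N := by
      have h := hN i j _ ha
      rw [pderiv_monomial, X, monomial_mul, one_mul, one_mul, ← add_assoc, add_tsub_cancel_right] at h
      have hne : (((e + a' + Finsupp.single j 1 : Fin m →₀ ℕ) j : ℕ) : K) ≠ 0 := by
        rw [Nat.cast_ne_zero]; simp
      have h2 := N.smul_mem (((e + a' + Finsupp.single j 1 : Fin m →₀ ℕ) j : ℕ) : K)⁻¹ h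
      rw [smul_monomial, smul_eq_mul, inv_mul_cancel₀ hne] at h2
      convert h2 using 2
      rw [add_right_comm, add_comm]
    have := ih a' b' (e + Finsupp.single i 1) (ha'.trans hb'.symm) hmove ha'
    convert this using 2
    rw [add_assoc, add_comm b']

theorem exists_forall_monomial_mem [CharZero K] {τ : K} (hτ : Function.Injective fun k : ℕ => τ ^ k)
    (hd : ∀ i, c i i = 1 - τ) (hadj : ∀ i j : Fin m, (i : ℕ) + 1 = j → c i j ≠ 0 ∧ c j i = c i j)
    (w : Fin m → Fin m → K) (hw : ∀ j k, ∑ i, w j i * c i k = if j = k then 1 else 0)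
    (hN : ∀ i, ∀ f ∈ N, reflHom c i f ∈ N) (h0 : N ≠ ⊥) :
    ∃ a : Fin m →₀ ℕ, ∀ b, b.degree = a.degree → monomial b (1 : K) ∈ N := by
  have h1 := X_mul_pderiv_mem c N w hw (vecField_mem c N hτ hd hadj hN)
  obtain ⟨a, ha⟩ := exists_monomial_mem N (fun i => h1 i i) h0
  refine ⟨a, fun b hb => ?_⟩
  have := monomial_mem_of_degree_eq N h1 a b 0 hb.symm (by rwa [zero_add])
  rwa [zero_add] at this

end Reflections

/-! ### The reduced Burau form -/

section Burau

variable {K : Type*} [Field K]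

/-- The tridiagonal matrix whose pseudo-reflections give the reduced Burau representation. -/
def burau (s : K) (m : ℕ) (i j : Fin m) : K :=
  if i = j then 1 + s⁻¹ ^ 2 else if (i : ℕ) + 1 = j ∨ (j : ℕ) + 1 = i then -s⁻¹ else 0

theorem eq_zero_of_burau_mulVec {s : K} (hs : s ≠ 0) (hs1 : ∀ k : ℕ, k ≠ 0 → s ^ k ≠ 1) {m : ℕ}
    (u : Fin m → K) (hu : ∀ k, ∑ j, burau s m k j * u j = 0) : u = 0 := by
  let U (t : ℕ) : K := ∑ j : Fin m, if (j : ℕ) + 1 = t then u j else 0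
  have hUu (k : Fin m) : U (k + 1) = u k := by
    simp only [U]
    rw [Finset.sum_eq_single k]
    · simp
    · intro j _ hj
      rw [if_neg]
      intro h
      exact hj (Fin.ext (by omega))
    · simp
  have hU0 : U 0 = 0 := by simp [U]
  have hUm : U (m + 1) = 0 := by
    simp only [U]
    refine Finset.sum_eq_zero fun j _ => if_neg ?_
    omega
  have hrec (k : ℕ) (hk : k < m) : U (k + 2) = (s + s⁻¹) * U (k + 1) - U k := by
    have h := hu ⟨k, hk⟩
    have hrow (j : Fin m) : burau s m ⟨k, hk⟩ j * u j =
        (1 + s⁻¹ ^ 2) * (if (j : ℕ) + 1 = k + 1 then u j else 0) +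
          (-s⁻¹) * (if (j : ℕ) + 1 = k + 2 then u j else 0) +
          (-s⁻¹) * (if (j : ℕ) + 1 = k then u j else 0) := by
      simp only [burau, Fin.ext_iff]
      split_ifs <;> first | omega | simp
    simp only [hrow, Finset.sum_add_distrib, ← Finset.mul_sum] at h
    change (1 + s⁻¹ ^ 2) * U (k + 1) + -s⁻¹ * U (k + 2) + -s⁻¹ * U k = 0 at h
    field_simp at h ⊢
    linear_combination (-1 : K) * h
  have hclosed (t : ℕ) (ht : t ≤ m) : (s - s⁻¹) * U t = (s ^ t - s⁻¹ ^ t) * U 1 ∧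
      (s - s⁻¹) * U (t + 1) = (s ^ (t + 1) - s⁻¹ ^ (t + 1)) * U 1 := by
    induction t with
    | zero => simp [hU0]
    | succ t ih =>
      obtain ⟨h₁, h₂⟩ := ih (by omega)
      refine ⟨h₂, ?_⟩
      rw [hrec t (by omega)]
      have hss : s * s⁻¹ = 1 := mul_inv_cancel₀ hs
      linear_combination (s + s⁻¹) * h₂ - h₁ + (s ^ t - s⁻¹ ^ t) * U 1 * hss
  have hne : ∀ k : ℕ, k ≠ 0 → s ^ k - s⁻¹ ^ k ≠ 0 := by
    intro k hk h
    refine hs1 (2 * k) (by omega) ?_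
    have hk1 : s ^ k * s⁻¹ ^ k = 1 := by rw [← mul_pow, mul_inv_cancel₀ hs, one_pow]
    rw [two_mul, pow_add]
    linear_combination s ^ k * h + hk1
  have hU1 : U 1 = 0 := by
    have h := (hclosed m le_rfl).2
    rw [hUm, mul_zero] at h
    exact (mul_eq_zero.mp h.symm).resolve_left (hne _ (Nat.succ_ne_zero m))
  funext k
  have h := (hclosed k k.2.le).2
  rw [hU1, mul_zero, hUu] at h
  exact (mul_eq_zero.mp h).resolve_left (by simpa using hne 1 one_ne_zero)

theorem exists_burau_inverse {s : K} (hs : s ≠ 0) (hs1 : ∀ k : ℕ, k ≠ 0 → s ^ k ≠ 1) (m : ℕ) :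
    ∃ w : Fin m → Fin m → K, ∀ j k, ∑ i, w j i * burau s m i k = if j = k then 1 else 0 := by
  let B : Matrix (Fin m) (Fin m) K := Matrix.of (burau s m)
  have hdet : IsUnit B.det := by
    rw [isUnit_iff_ne_zero]
    intro h
    obtain ⟨u, hu0, hu⟩ := Matrix.exists_mulVec_eq_zero_iff.mpr h
    exact hu0 (eq_zero_of_burau_mulVec hs hs1 u fun k => congrFun hu k)
  refine ⟨(B⁻¹ : Matrix (Fin m) (Fin m) K), fun j k => ?_⟩
  have := congrFun (congrFun (Matrix.nonsing_inv_mul B hdet) j) k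
  rw [Matrix.mul_apply, Matrix.one_apply] at this
  exact this

theorem injective_pow_neg_inv_sq {s : K} (hs : s ≠ 0) (hs1 : ∀ k : ℕ, k ≠ 0 → s ^ k ≠ 1) :
    Function.Injective fun k : ℕ => (-s⁻¹ ^ 2) ^ k := by
  have key (a d : ℕ) (h : (-s⁻¹ ^ 2) ^ a = (-s⁻¹ ^ 2) ^ (a + d)) : d = 0 := by
    by_contra hd
    have h0 : (-s⁻¹ ^ 2 : K) ≠ 0 := by simp [hs]
    rw [pow_add, left_eq_mul₀ (pow_ne_zero _ h0)] at h
    refine hs1 (4 * d) (by omega) ?_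
    have h2 : ((-s⁻¹ ^ 2) ^ d) ^ 2 * s ^ (4 * d) = 1 := by
      rw [pow_mul s, ← pow_mul, mul_comm d 2, pow_mul, ← mul_pow]
      have : (-s⁻¹ ^ 2) ^ 2 * s ^ 4 = 1 := by field_simp
      rw [this, one_pow]
    rwa [h, one_pow, one_mul] at h2
  intro a b h
  rcases le_total a b with hab | hab
  · obtain ⟨d, rfl⟩ := Nat.exists_eq_add_of_le hab
    rw [key a d h, add_zero]
  · obtain ⟨d, rfl⟩ := Nat.exists_eq_add_of_le hab
    rw [key b d h.symm, add_zero]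

end Burau

/-- A family annihilated by a weighted sum of lowering operators is determined by its entries with
`α p = 0`. -/
theorem eq_zero_of_lowering {n : ℕ} {R : Type*} [CommRing R] [IsDomain R] (h : (Fin n → ℕ) → R)
    (w : Fin n → (Fin n → ℕ) → R) (p : Fin n) (hw : ∀ β, w p β ≠ 0)
    (hE : ∀ β, ∑ j, w j β * h (Function.update β j (β j + 1)) = 0)
    (h0 : ∀ α, α p = 0 → h α = 0) (α : Fin n → ℕ) : h α = 0 := by
  induction ht : α p generalizing α with
  | zero => exact h0 α ht
  | succ t ih =>
    have hβ := hE (Function.update α p t)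
    rw [Finset.sum_eq_single p, Function.update_self, Function.update_idem, ← ht,
      Function.update_eq_self] at hβ
    · exact (mul_eq_zero.mp hβ).resolve_left (hw _)
    · intro j _ hj
      rw [ih _ (by rw [Function.update_of_ne hj.symm, Function.update_self]), mul_zero]
    · simp

/-! ### Polynomials in the linear forms killed by the specialization of `E` -/

section Polynomial

open MvPolynomial

variable {K : Type*} [Field K] (s : K) {n : ℕ}

/-- The specialization of `E` at `q = 1`. -/
def polyE (n : ℕ) : Derivation K (MvPolynomial (Fin n) K) (MvPolynomial (Fin n) K) :=
  mkDerivation K fun j => C (s ^ (n - 1 - (j : ℕ)))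

/-- The substitution of the linear forms `x_{i+1} - s⁻¹ x_i`. -/
def diffHom (n : ℕ) : MvPolynomial (Fin (n - 1)) K →ₐ[K] MvPolynomial (Fin n) K :=
  aeval fun i => X (rightStrand i) - C s⁻¹ * X (leftStrand i)

/-- The specialization of the braid generators at `q = 1`. -/
def polyBraid (i : Fin (n - 1)) : MvPolynomial (Fin n) K →ₐ[K] MvPolynomial (Fin n) K :=
  aeval fun k =>
    if k = leftStrand i then C s⁻¹ * X (rightStrand i) + C (1 - s⁻¹ ^ 2) * X (leftStrand i)
    else if k = rightStrand i then C s⁻¹ * X (leftStrand i) else X k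

theorem polyBraid_left (i : Fin (n - 1)) : polyBraid s i (X (leftStrand i)) =
    C s⁻¹ * X (rightStrand i) + C (1 - s⁻¹ ^ 2) * X (leftStrand i) := by
  rw [polyBraid, aeval_X, if_pos rfl]

theorem polyBraid_right (i : Fin (n - 1)) : polyBraid s i (X (rightStrand i)) =
    C s⁻¹ * X (leftStrand i) := by
  rw [polyBraid, aeval_X, if_neg (leftStrand_ne_rightStrand i).symm, if_pos rfl]

theorem polyBraid_of_ne (i : Fin (n - 1)) {k : Fin n} (h₁ : k ≠ leftStrand i)
    (h₂ : k ≠ rightStrand i) : polyBraid s i (X k) = X k := by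
  rw [polyBraid, aeval_X, if_neg h₁, if_neg h₂]

theorem polyBraid_diffHom (i : Fin (n - 1)) (f : MvPolynomial (Fin (n - 1)) K) :
    polyBraid s i (diffHom s n f) = diffHom s n (reflHom (burau s (n - 1)) i f) := by
  have key : (polyBraid s i).comp (diffHom s n) =
      (diffHom s n).comp (reflHom (burau s (n - 1)) i) := by
    refine algHom_ext fun j => ?_
    simp only [AlgHom.comp_apply, reflHom, aeval_X, map_sub, map_mul]
    simp only [diffHom, aeval_X, map_sub, map_mul, algHom_C, algebraMap_eq]
    rcases lt_trichotomy j i with h | rfl | h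
    · have hne : leftStrand j ≠ leftStrand i := by
        simp only [leftStrand, ne_eq, Fin.mk.injEq]; rw [Fin.lt_def] at h; omega
      have hne' : leftStrand j ≠ rightStrand i := by
        simp only [leftStrand, rightStrand, ne_eq, Fin.mk.injEq]; rw [Fin.lt_def] at h; omega
      rw [polyBraid_of_ne s i hne hne']
      by_cases h1 : (j : ℕ) + 1 = i
      · have e : rightStrand j = leftStrand i := by
          simp only [leftStrand, rightStrand, Fin.mk.injEq]; omega
        rw [e, polyBraid_left, burau, if_neg h.ne', if_pos (Or.inr h1)]
        simp only [map_sub, map_neg, map_one, map_pow]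
        ring
      · rw [Fin.lt_def] at h
        have hn1 : rightStrand j ≠ leftStrand i := by
          simp only [leftStrand, rightStrand, ne_eq, Fin.mk.injEq]; omega
        have hn2 : rightStrand j ≠ rightStrand i := by
          simp only [rightStrand, ne_eq, Fin.mk.injEq]; omega
        rw [polyBraid_of_ne s i hn1 hn2, burau, if_neg (by rw [Fin.ext_iff]; omega),
          if_neg (by omega)]
        simp
    · rw [polyBraid_left, polyBraid_right, burau, if_pos rfl]
      simp only [map_sub, map_add, map_one, map_pow]
      ring
    · have hne : rightStrand j ≠ leftStrand i := by
        simp only [leftStrand, rightStrand, ne_eq, Fin.mk.injEq]; rw [Fin.lt_def] at h; omega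
      have hne' : rightStrand j ≠ rightStrand i := by
        simp only [rightStrand, ne_eq, Fin.mk.injEq]; rw [Fin.lt_def] at h; omega
      rw [polyBraid_of_ne s i hne hne']
      by_cases h1 : (i : ℕ) + 1 = j
      · have e : leftStrand j = rightStrand i := by
          simp only [leftStrand, rightStrand, Fin.mk.injEq]; omega
        rw [e, polyBraid_right, burau, if_neg h.ne, if_pos (Or.inl h1)]
        simp only [map_neg]
        ring
      · rw [Fin.lt_def] at h
        have hn1 : leftStrand j ≠ leftStrand i := by
          simp only [leftStrand, ne_eq, Fin.mk.injEq]; omega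
        have hn2 : leftStrand j ≠ rightStrand i := by
          simp only [leftStrand, rightStrand, ne_eq, Fin.mk.injEq]; omega
        rw [polyBraid_of_ne s i hn1 hn2, burau, if_neg (by rw [Fin.ext_iff]; omega),
          if_neg (by omega)]
        simp
  exact DFunLike.congr_fun key f

/-- The linear forms which solve `L_{k+1} - s⁻¹ L_k = y_k`, `L_0 = 0`. -/
def diffInvForm (m : ℕ) : ℕ → MvPolynomial (Fin m) K
  | 0 => 0
  | k + 1 => C s⁻¹ * diffInvForm m k + if h : k < m then X ⟨k, h⟩ else 0

theorem diffHom_injective : Function.Injective (diffHom s n) := by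
  refine Function.LeftInverse.injective
    (g := aeval fun k : Fin n => diffInvForm s (n - 1) (k : ℕ)) fun f => ?_
  have : (aeval fun k : Fin n => diffInvForm s (n - 1) (k : ℕ)).comp (diffHom s n) =
      AlgHom.id K _ := by
    refine algHom_ext fun i => ?_
    rw [AlgHom.comp_apply, diffHom, aeval_X, map_sub, map_mul, aeval_X, aeval_X, algHom_C]
    simp [rightStrand, leftStrand, diffInvForm]
  exact DFunLike.congr_fun this f

theorem isHomogeneous_diffHom {f : MvPolynomial (Fin (n - 1)) K} {d : ℕ} (hf : f.IsHomogeneous d) :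
    (diffHom s n f).IsHomogeneous d := by
  have := hf.aeval (fun i => X (rightStrand i) - C s⁻¹ * X (leftStrand i)) (n := 1)
    (S := K) (fun i => (isHomogeneous_X _ _).sub (by
      simpa using (isHomogeneous_C _ _).mul (isHomogeneous_X _ _)))
  simpa [diffHom] using this

theorem polyE_diffHom (hs : s ≠ 0) (f : MvPolynomial (Fin (n - 1)) K) :
    polyE s n (diffHom s n f) = 0 := by
  induction f using MvPolynomial.induction_on with
  | C a => rw [diffHom, algHom_C]; simp [polyE]
  | add p q hp hq => rw [map_add, map_add, hp, hq, add_zero]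
  | mul_X p i hp =>
    rw [map_mul, Derivation.leibniz, hp, smul_zero, add_zero]
    have : polyE s n (diffHom s n (X i)) = 0 := by
      rw [diffHom, aeval_X, map_sub, Derivation.leibniz, polyE, mkDerivation_X, mkDerivation_X,
        derivation_C, smul_zero, add_zero, smul_eq_mul, ← map_mul, ← map_sub]
      have e : n - 1 - (leftStrand i : ℕ) = n - 1 - (rightStrand i : ℕ) + 1 := by
        simp only [leftStrand, rightStrand]; omega
      rw [e, pow_succ']
      field_simp
      simp
    rw [this, smul_zero]

theorem coeff_polyE (f : MvPolynomial (Fin n) K) (β : Fin n →₀ ℕ) :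
    coeff β (polyE s n f) = ∑ j : Fin n,
      (s ^ (n - 1 - (j : ℕ)) * (β j + 1)) * coeff (β + Finsupp.single j 1) f := by
  rw [polyE, mkDerivation_C_eq_sum, coeff_sum]
  refine Finset.sum_congr rfl fun j _ => ?_
  rw [coeff_smul, coeff_pderiv, smul_eq_mul]
  ring

theorem eq_zero_of_polyE_eq_zero [CharZero K] (hs : s ≠ 0) (p : Fin n) {f : MvPolynomial (Fin n) K}
    (hf : polyE s n f = 0) (h0 : ∀ α : Fin n →₀ ℕ, α p = 0 → coeff α f = 0) : f = 0 := by
  ext α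
  have := eq_zero_of_lowering (fun α => coeff (Finsupp.equivFunOnFinite.symm α) f)
    (fun j β => s ^ (n - 1 - (j : ℕ)) * (β j + 1)) p
    (fun β => mul_ne_zero (pow_ne_zero _ hs) (Nat.cast_add_one_ne_zero _)) (fun β => by
      have h := coeff_polyE s f (Finsupp.equivFunOnFinite.symm β)
      rw [hf, coeff_zero] at h
      rw [h]
      refine Finset.sum_congr rfl fun j _ => ?_
      congr 2
      ext k
      by_cases hk : k = j
      · subst hk; simp
      · simp [hk])
    (fun α hα => h0 _ hα) α
  simpa using this

/-- The substitution `x_p = 0`. -/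
def killHom (p : Fin n) : MvPolynomial (Fin n) K →ₐ[K] MvPolynomial (Fin n) K :=
  aeval fun k => if k = p then 0 else X k

theorem coeff_killHom (p : Fin n) (f : MvPolynomial (Fin n) K) {α : Fin n →₀ ℕ} (hα : α p = 0) :
    coeff α (killHom p f) = coeff α f := by
  induction f using MvPolynomial.induction_on' with
  | add p q hp hq => rw [map_add, coeff_add, coeff_add, hp, hq]
  | monomial u a =>
    by_cases hu : u p = 0
    · have : killHom p (monomial u a) = monomial u a := by
        rw [killHom, aeval_monomial, monomial_eq, algebraMap_eq]
        congr 1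
        refine Finsupp.prod_congr fun k hk => ?_
        rw [if_neg]
        rintro rfl
        exact Finsupp.mem_support_iff.mp hk hu
      rw [this]
    · have : killHom p (monomial u a) = 0 := by
        rw [killHom, aeval_monomial, Finsupp.prod,
          Finset.prod_eq_zero (Finsupp.mem_support_iff.mpr hu), mul_zero]
        rw [if_pos rfl, zero_pow hu]
      rw [this, coeff_zero, coeff_monomial, if_neg]
      rintro rfl
      exact hu hα

theorem mem_range_diffHom [CharZero K] (hs : s ≠ 0) (p : Fin n) (hp : (p : ℕ) + 1 = n)
    {f : MvPolynomial (Fin n) K} (hf : polyE s n f = 0) : ∃ g, diffHom s n g = f := by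
  set A := ((killHom p).comp (diffHom s n)).range with hA
  have hlast (d : ℕ) : ∀ k : Fin n, (k : ℕ) + d + 1 = n → killHom p (X k) ∈ A := by
    induction d with
    | zero =>
      intro k hk
      obtain rfl : k = p := Fin.ext (by omega)
      have : killHom (K := K) k (X k) = 0 := by rw [killHom, aeval_X, if_pos rfl]
      rw [this]; exact A.zero_mem
    | succ d ih =>
      intro k hk
      let i : Fin (n - 1) := ⟨k, by omega⟩
      have hi : leftStrand i = k := rfl
      have h₁ := ih (rightStrand i) (by simp only [rightStrand, i]; omega)
      have h₂ : killHom p (diffHom s n (X i)) ∈ A := ⟨X i, rfl⟩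
      have e : killHom p (X k) = C s * (killHom p (X (rightStrand i)) -
          killHom p (diffHom s n (X i))) := by
        rw [diffHom, aeval_X, map_sub, map_mul, algHom_C, algebraMap_eq, hi, sub_sub_cancel,
          ← mul_assoc, ← map_mul, mul_inv_cancel₀ hs, map_one, one_mul]
      rw [e, ← algebraMap_eq, ← Algebra.smul_def]
      exact A.smul_mem (A.sub_mem h₁ h₂) _
  have hmem : killHom p f ∈ A := by
    clear hf
    induction f using MvPolynomial.induction_on with
    | C a => rw [algHom_C]; exact A.algebraMap_mem a
    | add p q hp hq => rw [map_add]; exact A.add_mem hp hq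
    | mul_X q k hq =>
      rw [map_mul]
      exact A.mul_mem hq (hlast (n - 1 - k) k (by omega))
  obtain ⟨g, hg⟩ := hmem
  refine ⟨g, ?_⟩
  rw [← sub_eq_zero]
  refine eq_zero_of_polyE_eq_zero s hs p (by rw [map_sub, hf, polyE_diffHom s hs, sub_zero])
    fun α hα => ?_
  rw [coeff_sub, ← coeff_killHom p _ hα, ← coeff_killHom p f hα, sub_eq_zero]
  exact congrArg (coeff α) hg

/-- Irreducibility of the braid group action on homogeneous polynomials killed by `E`. -/
theorem diffHom_monomial_mem [CharZero K] (hs : s ≠ 0) (hs1 : ∀ k : ℕ, k ≠ 0 → s ^ k ≠ 1) (hn : n ≠ 0) (l : ℕ)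
    (N : Submodule K (MvPolynomial (Fin n) K)) (hN : ∀ i, ∀ f ∈ N, polyBraid s i f ∈ N)
    (hE : ∀ f ∈ N, polyE s n f = 0) (hl : ∀ f ∈ N, f.IsHomogeneous l) (h0 : N ≠ ⊥)
    (b : Fin (n - 1) →₀ ℕ) (hb : b.degree = l) : diffHom s n (monomial b 1) ∈ N := by
  obtain ⟨w, hw⟩ := exists_burau_inverse hs hs1 (n - 1)
  obtain ⟨a, ha⟩ := exists_forall_monomial_mem (burau s (n - 1)) (N.comap (diffHom s n).toLinearMap)
    (injective_pow_neg_inv_sq hs hs1) (fun i => by simp [burau]) (fun i j hij => by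
      have h1 : i ≠ j := by rw [ne_eq, Fin.ext_iff]; omega
      simp [burau, hij, h1, h1.symm, hs]) w hw (fun i f hf => by
      rw [Submodule.mem_comap, AlgHom.toLinearMap_apply] at hf ⊢
      rw [← polyBraid_diffHom]
      exact hN i _ hf) (by
      obtain ⟨f, hf, hf0⟩ := N.ne_bot_iff.mp h0
      obtain ⟨g, rfl⟩ := mem_range_diffHom s hs ⟨n - 1, by omega⟩
        (show n - 1 + 1 = n by omega) (hE f hf)
      rw [Submodule.ne_bot_iff]
      exact ⟨g, hf, fun h => hf0 (by rw [h, map_zero])⟩)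
  have hal : a.degree = l := by
    have h₁ := hl _ (ha a rfl)
    have h₂ : (diffHom s n (monomial a 1)).IsHomogeneous a.degree :=
      isHomogeneous_diffHom s (isHomogeneous_monomial _ rfl)
    refine h₂.inj_right h₁ fun h => ?_
    have := diffHom_injective s (h.trans (map_zero _).symm)
    simp at this
  exact ha b (hb.trans hal.symm)

end Polynomial

/-! ### Reduction of the tensor powers at `q = 1` -/

section Reduction

open MvPolynomial

instance specAlgebra : Algebra LRing SField := spec.toAlgebra

theorem smul_eq_spec_smul (r : LRing) {n : ℕ} (f : MvPolynomial (Fin n) SField) :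
    r • f = spec r • f := by
  ext α
  rw [coeff_smul, coeff_smul, Algebra.smul_def]
  rfl

variable {n : ℕ}

/-- The divided power monomial `∏ x_k ^ {α_k} / α_k!`. -/
def divMonomial (α : Fin n → ℕ) : MvPolynomial (Fin n) SField :=
  ∏ k, (C ((α k).factorial : SField)⁻¹ * X k ^ α k)

theorem divMonomial_eq (α : Fin n → ℕ) : divMonomial α =
    monomial (Finsupp.equivFunOnFinite.symm α) (∏ k, ((α k).factorial : SField)⁻¹) := by
  rw [divMonomial, Finset.prod_mul_distrib, monomial_eq, map_prod, Finsupp.prod_fintype]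
  · rfl
  · simp

/-- The reduction of `V ^ {⊗ n}` at `q = 1`, with values in polynomials over `ℚ(s)`. -/
def reduction (n : ℕ) : VermaPow n →ₗ[LRing] MvPolynomial (Fin n) SField :=
  (vermaPowBasis n).constr LRing divMonomial

theorem reduction_basis (α : Fin n → ℕ) : reduction n (vermaPowBasis n α) = divMonomial α :=
  Module.Basis.constr_basis ..

theorem coeff_reduction (x : VermaPow n) (α : Fin n → ℕ) :
    coeff (Finsupp.equivFunOnFinite.symm α) (reduction n x) =
      spec ((vermaPowBasis n).repr x α) * ∏ k, ((α k).factorial : SField)⁻¹ := by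
  induction (vermaPowBasis n).mem_span x using Submodule.span_induction with
  | zero => simp
  | mem x hx =>
    obtain ⟨β, rfl⟩ := hx
    rw [reduction_basis, divMonomial_eq, coeff_monomial, Module.Basis.repr_self,
      Finsupp.single_apply]
    simp only [EmbeddingLike.apply_eq_iff_eq]
    split_ifs with h
    · rw [h, map_one, one_mul]
    · rw [map_zero, zero_mul]
  | add x y _ _ hx hy =>
    rw [map_add, coeff_add, hx, hy, map_add, Finsupp.add_apply, map_add, add_mul]
  | smul c x _ hx =>
    rw [map_smul, smul_eq_spec_smul, coeff_smul, hx, map_smul, Finsupp.smul_apply, smul_eq_mul,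
      smul_eq_mul, map_mul, mul_assoc]

theorem isHomogeneous_reduction {l : ℕ} {x : VermaPow n} (hx : x ∈ weightSpace n l) :
    (reduction n x).IsHomogeneous l := by
  intro α hα
  have h := coeff_reduction x (α : Fin n → ℕ)
  rw [Finsupp.equivFunOnFinite_symm_coe] at h
  rw [h] at hα
  have hne : (vermaPowBasis n).repr x α ≠ 0 := by
    intro h0
    rw [h0, map_zero, zero_mul] at hα
    exact hα rfl
  have := (mem_weightSpace_iff l x).mp hx α hne
  change Finsupp.weight (fun _ => 1) α = l
  rw [← Finsupp.degree_eq_weight_one, Finsupp.degree_eq_sum]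
  exact this

theorem spec_coeffR (d b h : ℕ) : spec (coeffR (h + d) b h) =
    sK⁻¹ ^ (d + b) * (b + h).choose b * (1 - sK⁻¹ ^ 2) ^ h := by
  have hc (m : ℤ) : spec (curly m) = sK - sK⁻¹ := by
    rw [curly, mono, mono, map_sub, map_mul, map_mul, spec_qPow, spec_qPow, spec_sPow, spec_sPow]
    simp
  rw [coeffR_eq, map_mul, map_mul, mono, map_mul, spec_qPow, spec_sPow, curlyProd, map_prod,
    add_comm h b, spec_qBinom]
  simp only [hc, Finset.prod_const, Finset.card_range]
  have hs := sK_ne_zero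
  have e1 : sK ^ (-(((h + d : ℕ) : ℤ) + b)) = sK⁻¹ ^ (d + b) * sK⁻¹ ^ h := by
    rw [← pow_add, inv_pow, ← zpow_natCast, ← zpow_neg]
    congr 1; push_cast; ring
  have e2 : sK - sK⁻¹ = sK * (1 - sK⁻¹ ^ 2) := by field_simp
  rw [e1, e2, mul_pow]
  have e3 : sK⁻¹ ^ h * sK ^ h = 1 := by rw [← mul_pow, inv_mul_cancel₀ hs, one_pow]
  linear_combination sK⁻¹ ^ (d + b) * ((b + h).choose b) * (1 - sK⁻¹ ^ 2) ^ h * e3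

theorem divMonomial_upd (i : Fin (n - 1)) (α : Fin n → ℕ) (x y : ℕ) :
    divMonomial (upd i α x y) =
      (C (x.factorial : SField)⁻¹ * X (leftStrand i) ^ x) *
        (C (y.factorial : SField)⁻¹ * X (rightStrand i) ^ y) *
      ∏ k ∈ Finset.univ \ {leftStrand i, rightStrand i},
        (C ((α k).factorial : SField)⁻¹ * X k ^ α k) :=
  prod_upd i (fun k a => (C (a.factorial : SField)⁻¹ * X k ^ a : MvPolynomial (Fin n) SField)) α x y

theorem spec_coeffR_smul (i : Fin (n - 1)) (d b h : ℕ) :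
    spec (coeffR (h + d) b h) • ((C ((b + h).factorial : SField)⁻¹ * X (leftStrand i) ^ (b + h)) *
        (C (d.factorial : SField)⁻¹ * X (rightStrand i) ^ d)) =
    (C ((h + d).factorial : SField)⁻¹ *
      ((C (1 - sK⁻¹ ^ 2) * X (leftStrand i)) ^ h * (C sK⁻¹ * X (rightStrand i)) ^ d *
        ((h + d).choose h : MvPolynomial (Fin n) SField))) *
      (C (b.factorial : SField)⁻¹ * (C sK⁻¹ * X (leftStrand i)) ^ b) := by
  have hcast : ((h + d).choose h : MvPolynomial (Fin n) SField) =
      C ((h + d).choose h : SField) := by rw [map_natCast]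
  have key : spec (coeffR (h + d) b h) * ((b + h).factorial : SField)⁻¹ * (d.factorial : SField)⁻¹ =
      ((h + d).factorial : SField)⁻¹ * (1 - sK⁻¹ ^ 2) ^ h * sK⁻¹ ^ d * ((h + d).choose h) *
        (b.factorial : SField)⁻¹ * sK⁻¹ ^ b := by
    have hf (k : ℕ) : (k.factorial : SField) ≠ 0 := by exact_mod_cast k.factorial_ne_zero
    rw [spec_coeffR, Nat.cast_add_choose, Nat.cast_add_choose, pow_add]
    have := hf b; have := hf h; have := hf d; have := hf (b + h); have := hf (h + d)
    generalize sK⁻¹ = t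
    field_simp
  rw [smul_eq_C_mul, hcast]
  have hk := congrArg (C (σ := Fin n)) key
  simp only [map_mul, map_pow] at hk
  simp only [mul_pow]
  linear_combination (X (leftStrand i) ^ (b + h) * X (rightStrand i) ^ d) * hk

theorem reduction_braidOp (i : Fin (n - 1)) (x : VermaPow n) :
    reduction n (braidOp n i x) = polyBraid sK i (reduction n x) := by
  have key : reduction n ∘ₗ braidOp n i =
      ((polyBraid sK i).toLinearMap.restrictScalars LRing) ∘ₗ reduction n := by
    refine (vermaPowBasis n).ext fun α => ?_
    simp only [LinearMap.comp_apply, LinearMap.restrictScalars_apply, AlgHom.toLinearMap_apply]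
    rw [reduction_basis, braidOp_basis, map_famR, famR_apply]
    simp only [strandFam, reduction_basis, smul_eq_spec_smul]
    conv_rhs => rw [← upd_self i α]
    generalize α (leftStrand i) = a
    generalize α (rightStrand i) = b
    have hrest : polyBraid sK i (∏ k ∈ Finset.univ \ {leftStrand i, rightStrand i},
        (C ((α k).factorial : SField)⁻¹ * X k ^ α k)) =
        ∏ k ∈ Finset.univ \ {leftStrand i, rightStrand i},
        (C ((α k).factorial : SField)⁻¹ * X k ^ α k) := by
      rw [map_prod]
      refine Finset.prod_congr rfl fun k hk => ?_
      simp only [Finset.mem_sdiff, Finset.mem_univ, Finset.mem_insert, Finset.mem_singleton,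
        true_and, not_or] at hk
      rw [map_mul, map_pow, polyBraid_of_ne sK i hk.1 hk.2, algHom_C, algebraMap_eq]
    rw [divMonomial_upd, map_mul, hrest, map_mul, map_mul, map_mul, map_pow, map_pow,
      polyBraid_left, polyBraid_right, algHom_C, algHom_C, algebraMap_eq]
    simp only [divMonomial_upd, ← smul_mul_assoc]
    rw [← Finset.sum_mul]
    congr 1
    rw [add_comm (C sK⁻¹ * X (rightStrand i)), add_pow, Finset.mul_sum, Finset.sum_mul]
    refine Finset.sum_congr rfl fun h hh => ?_
    obtain ⟨d, rfl⟩ := Nat.exists_eq_add_of_le (Nat.lt_succ_iff.mp (Finset.mem_range.mp hh))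
    rw [Nat.add_sub_cancel_left]
    have := spec_coeffR_smul i d b h
    rwa [← smul_mul_assoc, ← smul_mul_assoc] at this
  exact LinearMap.congr_fun key x

theorem spec_prod_wtE (j : Fin n) (α : Fin n → ℕ) : spec (∏ k, wtE j k (α k)) =
    (if α j = 0 then 0 else 1) * sK ^ (n - 1 - (j : ℕ)) := by
  have hk (k : Fin n) : spec (wtE j k (α k)) =
      (if k = j then (if α j = 0 then 0 else 1) else 1) * (if j < k then sK else 1) := by
    rcases lt_trichotomy k j with h | rfl | h
    · simp [wtE, h, h.ne, h.not_gt]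
    · simp only [wtE, lt_irrefl, if_false, if_true]
      split_ifs <;> simp
    · simp [wtE, h, h.ne', h.not_gt, kap, mono, spec_qPow, spec_sPow]
  rw [map_prod]
  simp only [hk]
  rw [Finset.prod_mul_distrib, Finset.prod_ite_eq' Finset.univ j, if_pos (Finset.mem_univ _),
    Finset.prod_ite, Finset.prod_const, Finset.prod_const_one, mul_one]
  congr 2
  rw [show Finset.univ.filter (fun k => j < k) = Finset.Ioi j by ext; simp, Fin.card_Ioi]

theorem reduction_powE (x : VermaPow n) :
    reduction n (powE n x) = polyE sK n (reduction n x) := by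
  have key : reduction n ∘ₗ powE n =
      ((polyE sK n).toLinearMap.restrictScalars LRing) ∘ₗ reduction n := by
    refine (vermaPowBasis n).ext fun α => ?_
    simp only [LinearMap.comp_apply, LinearMap.restrictScalars_apply, Derivation.coeFn_coe]
    rw [powE_eq_sum, LinearMap.sum_apply, map_sum, reduction_basis, polyE, mkDerivation_C_eq_sum]
    refine Finset.sum_congr rfl fun j _ => ?_
    rw [powEAt_basis, map_smul, reduction_basis, smul_eq_spec_smul, spec_prod_wtE, mul_comm,
      mul_smul]
    congr 1
    rw [divMonomial_eq α, pderiv_monomial]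
    split_ifs with h
    · simp [h]
    · rw [one_smul, divMonomial_eq]
      obtain ⟨t, ht⟩ := Nat.exists_eq_succ_of_ne_zero h
      refine congrArg₂ (fun a c => monomial a c) ?_ ?_
      · ext k
        by_cases hk : k = j
        · subst hk; simp
        · simp [hk]
      · rw [← Finset.mul_prod_erase Finset.univ _ (Finset.mem_univ j),
          ← Finset.mul_prod_erase Finset.univ (fun k => ((α k).factorial : SField)⁻¹)
            (Finset.mem_univ j)]
        have he : ∏ k ∈ Finset.univ.erase j,
            ((Function.update α j (α j - 1) k).factorial : SField)⁻¹ =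
            ∏ k ∈ Finset.univ.erase j, ((α k).factorial : SField)⁻¹ :=
          Finset.prod_congr rfl fun k hk => by
            rw [Function.update_of_ne (Finset.ne_of_mem_erase hk)]
        rw [he, Function.update_self, Finsupp.equivFunOnFinite_symm_apply_apply, ht,
          Nat.succ_sub_one, Nat.factorial_succ]
        have h1 : (t.factorial : SField) ≠ 0 := by exact_mod_cast t.factorial_ne_zero
        have h2 : ((t + 1 : ℕ) : SField) ≠ 0 := Nat.cast_ne_zero.mpr (Nat.succ_ne_zero t)
        push_cast at h2 ⊢
        field_simp
  exact LinearMap.congr_fun key x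

theorem polyE_reduction_eq_zero {l : ℕ} (w : highestWeightSpace n l) :
    polyE sK n (reduction n w) = 0 := by
  rw [← reduction_powE]
  have : powE n (w : VermaPow n) = 0 := w.2.1
  rw [this, map_zero]

end Reduction

/-! ### Clearing powers of `q - 1` -/

section Scaling

variable {ι M : Type*} [AddCommGroup M] [Module LRing M]

theorem exists_eq_smul_of_forall_spec_repr_eq_zero (b : Module.Basis ι LRing M) {x : M}
    (h : ∀ i, spec (b.repr x i) = 0) : ∃ y, x = (qPow 1 - 1) • y := by
  choose c hc using fun i => qPow_sub_one_dvd_of_spec_eq_zero (h i)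
  refine ⟨∑ i ∈ (b.repr x).support, c i • b i, ?_⟩
  rw [Finset.smul_sum]
  conv_lhs => rw [← b.linearCombination_repr x, Finsupp.linearCombination_apply, Finsupp.sum]
  refine Finset.sum_congr rfl fun i _ => ?_
  rw [hc i, mul_smul]

theorem exists_eq_pow_smul (b : Module.Basis ι LRing M) {x : M} (hx : x ≠ 0) :
    ∃ (k : ℕ) (y : M), x = (qPow 1 - 1) ^ k • y ∧ ∃ i, spec (b.repr y i) ≠ 0 := by
  obtain ⟨i, hi⟩ : ∃ i, b.repr x i ≠ 0 := by
    by_contra! h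
    exact hx (b.repr.map_eq_zero_iff.mp (Finsupp.ext h))
  obtain ⟨m, hm⟩ := finiteMultiplicity_qPow_sub_one hi
  suffices H : ∀ (m : ℕ) (x : M), ¬ (qPow 1 - 1) ^ m ∣ b.repr x i →
      ∃ (k : ℕ) (y : M), x = (qPow 1 - 1) ^ k • y ∧ ∃ i, spec (b.repr y i) ≠ 0 from H _ x hm
  intro m
  induction m with
  | zero => intro x hx; simp at hx
  | succ m ih =>
    intro x hx
    by_cases h : ∃ i, spec (b.repr x i) ≠ 0
    · exact ⟨0, x, by simp, h⟩
    · push Not at h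
      obtain ⟨y, rfl⟩ := exists_eq_smul_of_forall_spec_repr_eq_zero b h
      rw [map_smul, Finsupp.smul_apply, smul_eq_mul, pow_succ'] at hx
      obtain ⟨k, z, rfl, hz⟩ := ih y fun hd => hx (mul_dvd_mul_left _ hd)
      exact ⟨k + 1, z, by rw [pow_succ', mul_smul], hz⟩

/-- Vectors with linearly independent reductions are linearly independent. -/
theorem linearIndependent_of_reduction [Module.IsTorsionFree LRing M] {n : ℕ}
    (f : M →ₗ[LRing] MvPolynomial (Fin n) SField) {w : ι → M}
    (hw : LinearIndependent SField fun i => f (w i)) : LinearIndependent LRing w := by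
  rw [linearIndependent_iff]
  intro c hc
  by_contra hne
  obtain ⟨k, d, rfl, i, hi⟩ := exists_eq_pow_smul Finsupp.basisSingleOne hne
  rw [map_smul, smul_eq_zero, or_iff_right (pow_ne_zero _ qPow_sub_one_ne_zero)] at hc
  have h := congrArg f hc
  rw [map_zero, Finsupp.linearCombination_apply, Finsupp.sum, map_sum] at h
  simp only [map_smul, smul_eq_spec_smul] at h
  have hz := linearIndependent_iff'.mp hw d.support (fun i => spec (d i)) h i
  refine hi (hz ?_)
  rw [Finsupp.mem_support_iff]
  intro h0
  refine hi ?_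
  change spec (d i) = 0
  rw [h0, map_zero]

end Scaling

/-! ### Coordinates on the highest weight spaces -/

section Coordinates

variable {n : ℕ}

theorem repr_powE (x : VermaPow n) (β : Fin n → ℕ) :
    (vermaPowBasis n).repr (powE n x) β =
      ∑ j, (∏ k, wtE j k (Function.update β j (β j + 1) k)) *
        (vermaPowBasis n).repr x (Function.update β j (β j + 1)) := by
  have key (j : Fin n) : (vermaPowBasis n).coord β ∘ₗ powEAt n j =
      (∏ k, wtE j k (Function.update β j (β j + 1) k)) •
        (vermaPowBasis n).coord (Function.update β j (β j + 1)) := by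
    refine (vermaPowBasis n).ext fun α => ?_
    simp only [LinearMap.comp_apply, powEAt_basis, map_smul, LinearMap.smul_apply,
      Module.Basis.coord_apply, Module.Basis.repr_self, Finsupp.single_apply, smul_eq_mul]
    by_cases hα : α = Function.update β j (β j + 1)
    · subst hα; simp
    · rw [if_neg hα, mul_zero]
      by_cases h0 : α j = 0
      · rw [Finset.prod_eq_zero (Finset.mem_univ j) (by simp [wtE, h0]), zero_mul]
      · rw [if_neg, mul_zero]
        rintro rfl
        refine hα (funext fun k => ?_)
        by_cases hk : k = j
        · subst hk; simp; omega
        · simp [hk]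
  rw [powE_eq_sum, LinearMap.sum_apply, map_sum, Finsupp.finsetSum_apply]
  exact Finset.sum_congr rfl fun j _ => LinearMap.congr_fun (key j) x

theorem wtE_succ_ne_zero (p : Fin n) (β : Fin n → ℕ) :
    ∏ k, wtE p k (Function.update β p (β p + 1) k) ≠ 0 := by
  refine Finset.prod_ne_zero_iff.mpr fun k _ => ?_
  rw [wtE]
  split_ifs with h₁ h₂ h₃
  · exact one_ne_zero
  · subst h₂; simp at h₃
  · exact one_ne_zero
  · exact mono_ne_zero _ _

/-- The exponents of the monomials of degree `l` in `n - 1` variables. -/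
abbrev DegreeIndex (n l : ℕ) : Type := {b : Fin (n - 1) →₀ ℕ | b.degree = l}

instance (n l : ℕ) : Fintype (DegreeIndex n l) :=
  (Finsupp.finite_of_degree_eq l).fintype

theorem exists_injective_coordinates (hn : n ≠ 0) (l : ℕ) :
    ∃ φ : highestWeightSpace n l →ₗ[LRing] (DegreeIndex n l → LRing), Function.Injective φ := by
  obtain ⟨m, rfl⟩ := Nat.exists_eq_succ_of_ne_zero hn
  let ext (b : Fin m → ℕ) : Fin (m + 1) → ℕ := Fin.snoc (α := fun _ => ℕ) b 0
  refine ⟨(LinearMap.pi fun b : DegreeIndex (m + 1) l =>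
    (vermaPowBasis (m + 1)).coord (ext b.1)) ∘ₗ (highestWeightSpace (m + 1) l).subtype, ?_⟩
  rw [injective_iff_map_eq_zero]
  intro w hw
  have hw' (b : DegreeIndex (m + 1) l) :
      (vermaPowBasis (m + 1)).repr (w : VermaPow (m + 1)) (ext b.1) = 0 := congrFun hw b
  have hE : powE (m + 1) (w : VermaPow (m + 1)) = 0 := w.2.1
  have h := eq_zero_of_lowering (fun α => (vermaPowBasis (m + 1)).repr (w : VermaPow (m + 1)) α)
    (fun j β => ∏ k, wtE j k (Function.update β j (β j + 1) k)) (Fin.last m)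
    (wtE_succ_ne_zero _) (fun β => by rw [← repr_powE, hE, map_zero]; rfl) ?_
  · exact Subtype.ext ((vermaPowBasis (m + 1)).repr.map_eq_zero_iff.mp (Finsupp.ext h))
  intro α hα
  by_contra hne
  have hl := (mem_weightSpace_iff l _).mp w.2.2 α hne
  have he : ext (Fin.init α) = α := by
    have := Fin.snoc_init_self (α := fun _ : Fin (m + 1) => ℕ) α
    rwa [hα] at this
  refine hne ?_
  have := hw' ⟨Finsupp.equivFunOnFinite.symm (Fin.init α), by
    rw [Set.mem_ofPred_eq, Finsupp.degree_eq_sum, ← hl, Fin.sum_univ_castSucc, hα, add_zero]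
    rfl⟩
  rwa [Finsupp.coe_equivFunOnFinite_symm, he] at this

/-! ### Highest weight vectors exist -/

theorem powE_strandFam_zero (i : Fin (n - 1)) (x y : ℕ) :
    powE n (strandFam i 0 x y) = restWt i 0 • famDE (strandFam i 0) x y := by
  have hs : powE n = (powEAt n (leftStrand i) + powEAt n (rightStrand i)) +
      ∑ k ∈ Finset.univ \ {leftStrand i, rightStrand i}, powEAt n k := by
    rw [powE_eq_sum, sum_eq_add_add_sum_sdiff i]
  rw [hs, LinearMap.add_apply, powEAt_add_strandFam, LinearMap.sum_apply,
    Finset.sum_eq_zero, add_zero]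
  intro j hj
  have h := hj
  simp only [Finset.mem_sdiff, Finset.mem_univ, Finset.mem_insert, Finset.mem_singleton,
    true_and, not_or] at h
  rw [powEAt_strandFam_of_ne i h.1 h.2, Finset.prod_eq_zero hj (by simp [wtE]), mul_zero, zero_smul]

theorem sum_smul_famDE {Z : Type*} [AddCommGroup Z] [Module LRing Z] (f : ℕ → ℕ → Z) (l m : ℕ)
    (hm : m ≤ l) :
    ∑ b ∈ Finset.range (m + 1), (∏ k ∈ Finset.range b, -kap k) • famDE f (l - b) b =
      (∏ k ∈ Finset.range m, -kap k) • famEK f (l - m) m := by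
  induction m with
  | zero => simp [famDE_apply, famE_zero]
  | succ m ih =>
    rw [Finset.sum_range_succ, ih (by omega), famDE_apply, Pi.add_apply, Pi.add_apply, famE_succ,
      show l - m = l - (m + 1) + 1 by omega, famEK_succ, Finset.prod_range_succ, smul_add, mul_smul,
      mul_smul, neg_smul, neg_smul, smul_neg, smul_neg]
    abel

/-- A highest weight vector supported on two adjacent strands. -/
def strandVector (i : Fin (n - 1)) (l : ℕ) : VermaPow n :=
  ∑ b ∈ Finset.range (l + 1), (∏ k ∈ Finset.range b, -kap k) • strandFam i 0 (l - b) b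

theorem strandVector_mem (i : Fin (n - 1)) (l : ℕ) :
    strandVector i l ∈ highestWeightSpace n l := by
  refine ⟨?_, Submodule.sum_mem _ fun b hb => Submodule.smul_mem _ _ ?_⟩
  · change powE n (strandVector i l) = 0
    rw [strandVector, map_sum]
    simp only [map_smul, powE_strandFam_zero]
    simp only [smul_comm _ (restWt i 0)]
    rw [← Finset.smul_sum, sum_smul_famDE _ l l le_rfl, Nat.sub_self, famEK_zero, smul_zero,
      smul_zero]
  · rw [weightSpace_eq_span]
    refine Submodule.subset_span ⟨_, ?_, rfl⟩
    rw [Finset.mem_range] at hb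
    rw [Set.mem_ofPred_eq, sum_upd i (fun _ a => a)]
    simp only [Pi.zero_apply, Finset.sum_const_zero]
    omega

theorem strandVector_ne_zero (i : Fin (n - 1)) (l : ℕ) : strandVector i l ≠ 0 := by
  intro h
  have h1 := congrArg (fun x => (vermaPowBasis n).repr x (upd i 0 l 0)) h
  simp only [strandVector, map_sum, map_smul, Finsupp.finsetSum_apply, strandFam,
    Module.Basis.repr_self, map_zero, Finsupp.coe_zero, Pi.zero_apply] at h1
  rw [Finset.sum_eq_single 0] at h1
  · simp at h1
  · intro b _ hb
    rw [Finsupp.smul_apply, Finsupp.single_apply, if_neg, smul_zero]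
    intro he
    have := congrFun he (rightStrand i)
    rw [upd_right, upd_right] at this
    exact hb this
  · simp

end Coordinates

/-! ### Irreducibility over the fraction field -/

section Irreducible

variable {n l : ℕ}

theorem finite_baseChange (hn : n ≠ 0) (l : ℕ) :
    Module.Finite LField (LField ⊗[LRing] highestWeightSpace n l) ∧
      Module.finrank LField (LField ⊗[LRing] highestWeightSpace n l) ≤
        Fintype.card (DegreeIndex n l) := by
  obtain ⟨φ, hφ⟩ := exists_injective_coordinates hn l
  have hinj : Function.Injective (φ.baseChange LField) :=
    Module.Flat.lTensor_preserves_injective_linearMap (M := LField) φ hφ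
  refine ⟨Module.Finite.of_injective _ hinj, ?_⟩
  refine (LinearMap.finrank_le_finrank_of_injective hinj).trans_eq ?_
  rw [Module.finrank_baseChange, Module.finrank_fintype_fun_eq_card]

instance : Module.IsTorsionFree LRing (VermaPow n) :=
  (vermaPowBasis n).repr.injective.moduleIsTorsionFree _ (map_smul _)

theorem tmul_one_injective :
    Function.Injective (TensorProduct.mk LRing LField (highestWeightSpace n l) 1) := by
  rw [injective_iff_map_eq_zero]
  intro w hw
  obtain ⟨c, hc⟩ := (IsLocalizedModule.eq_iff_exists (nonZeroDivisors LRing)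
    (TensorProduct.mk LRing LField (highestWeightSpace n l) 1)).mp (hw.trans (map_zero _).symm)
  rw [smul_zero, Submonoid.smul_def, smul_eq_zero] at hc
  exact hc.resolve_left (nonZeroDivisors.coe_ne_zero c)

/-- The vectors of the highest weight space which lie in a subspace of its scalar extension. -/
def latticeOf (U : Submodule LField (LField ⊗[LRing] highestWeightSpace n l)) :
    Submodule LRing (highestWeightSpace n l) :=
  (U.restrictScalars LRing).comap (TensorProduct.mk LRing LField (highestWeightSpace n l) 1)

variable {U : Submodule LField (LField ⊗[LRing] highestWeightSpace n l)}

theorem mem_latticeOf {w : highestWeightSpace n l} :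
    w ∈ latticeOf U ↔ (1 : LField) ⊗ₜ[LRing] w ∈ U := Iff.rfl

theorem mem_latticeOf_of_smul_mem {r : LRing} (hr : r ≠ 0) {w : highestWeightSpace n l}
    (h : r • w ∈ latticeOf U) : w ∈ latticeOf U := by
  rw [mem_latticeOf, TensorProduct.tmul_smul, ← algebraMap_smul LField r] at h
  exact (U.smul_mem_iff ((map_ne_zero_iff _ (IsFractionRing.injective LRing LField)).mpr hr)).mp h

theorem exists_reduction_ne_zero (hU : U ≠ ⊥) :
    ∃ w ∈ latticeOf U, reduction n (w : VermaPow n) ≠ 0 := by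
  obtain ⟨x, hx, hx0⟩ := U.ne_bot_iff.mp hU
  obtain ⟨⟨w, c⟩, hw⟩ := IsLocalizedModule.surj (nonZeroDivisors LRing)
    (TensorProduct.mk LRing LField (highestWeightSpace n l) 1) x
  simp only at hw
  have hcne : (c : LRing) ≠ 0 := nonZeroDivisors.coe_ne_zero c
  have hwU : w ∈ latticeOf U := by
    change TensorProduct.mk LRing LField (highestWeightSpace n l) 1 w ∈ U
    rw [← hw]
    exact (U.restrictScalars LRing).smul_mem (c : LRing) hx
  have hw0 : (w : VermaPow n) ≠ 0 := by
    intro h0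
    rw [show w = 0 from Subtype.ext h0, map_zero, Submonoid.smul_def, ← algebraMap_smul LField (c : LRing),
      smul_eq_zero] at hw
    exact hx0 (hw.resolve_left
      ((map_ne_zero_iff _ (IsFractionRing.injective LRing LField)).mpr hcne))
  obtain ⟨k, y, hy, α, hα⟩ := exists_eq_pow_smul (vermaPowBasis n) hw0
  have hk : (qPow 1 - 1 : LRing) ^ k ≠ 0 := pow_ne_zero _ qPow_sub_one_ne_zero
  have hyW : y ∈ highestWeightSpace n l := by
    have hwW := w.2
    rw [hy] at hwW
    refine ⟨?_, ?_⟩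
    · have := LinearMap.mem_ker.mp hwW.1
      rw [map_smul, smul_eq_zero] at this
      exact this.resolve_left hk
    · have := LinearMap.mem_ker.mp hwW.2
      rw [map_smul, smul_eq_zero] at this
      exact this.resolve_left hk
  refine ⟨⟨y, hyW⟩, mem_latticeOf_of_smul_mem hk ?_, fun h0 => hα ?_⟩
  · have : (qPow 1 - 1 : LRing) ^ k • (⟨y, hyW⟩ : highestWeightSpace n l) = w := Subtype.ext hy.symm
    rwa [this]
  · have h := coeff_reduction y α
    have h0' : reduction n y = 0 := h0
    rw [h0', MvPolynomial.coeff_zero, eq_comm, mul_eq_zero] at h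
    refine h.resolve_right (Finset.prod_ne_zero_iff.mpr fun k _ => inv_ne_zero ?_)
    exact_mod_cast (α k).factorial_ne_zero

/-- A nonzero subspace which is stable under the braid generators is everything. -/
theorem eq_top_of_stable (hn : n ≠ 0) (hU : U ≠ ⊥)
    (hstab : ∀ (i : Fin (n - 1)), ∀ w ∈ latticeOf U, braidRep n l (braidGen i) w ∈ latticeOf U) :
    U = ⊤ := by
  obtain ⟨hfin, hrank⟩ := finite_baseChange hn l
  set T : Set (MvPolynomial (Fin n) SField) :=
    (fun w : highestWeightSpace n l => reduction n (w : VermaPow n)) '' latticeOf U with hT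
  have hmem : ∀ b : Fin (n - 1) →₀ ℕ, b.degree = l →
      diffHom sK n (MvPolynomial.monomial b 1) ∈ Submodule.span SField T := by
    refine diffHom_monomial_mem sK sK_ne_zero (fun k hk => ?_) hn l _ (fun i f hf => ?_)
      (fun f hf => ?_) (fun f hf => ?_) ?_
    · rw [← zpow_natCast]
      exact sK_zpow_ne_one (by exact_mod_cast hk)
    · induction hf using Submodule.span_induction with
      | zero => rw [map_zero]; exact Submodule.zero_mem _
      | mem f hf =>
        obtain ⟨w, hw, rfl⟩ := hf
        refine Submodule.subset_span ⟨_, hstab i w hw, ?_⟩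
        simp only [braidRep_braidGen, reduction_braidOp]
      | add f g _ _ hf hg => rw [map_add]; exact Submodule.add_mem _ hf hg
      | smul c f _ hf => rw [map_smul]; exact Submodule.smul_mem _ c hf
    · induction hf using Submodule.span_induction with
      | zero => rw [map_zero]
      | mem f hf =>
        obtain ⟨w, hw, rfl⟩ := hf
        exact polyE_reduction_eq_zero w
      | add f g _ _ hf hg => rw [map_add, hf, hg, add_zero]
      | smul c f _ hf => rw [Derivation.map_smul, hf, smul_zero]
    · have hle : Submodule.span SField T ≤ MvPolynomial.homogeneousSubmodule (Fin n) SField l := by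
        rw [Submodule.span_le]
        rintro _ ⟨w, hw, rfl⟩
        exact isHomogeneous_reduction w.2.2
      exact hle hf
    · obtain ⟨w, hw, hne⟩ := exists_reduction_ne_zero hU
      exact (Submodule.ne_bot_iff _).mpr ⟨_, Submodule.subset_span ⟨w, hw, rfl⟩, hne⟩
  obtain ⟨B, hBT, hBspan, hB⟩ := exists_linearIndependent SField T
  choose w hwU hw using fun b : B => hBT b.2
  have hwli : LinearIndependent LRing w := by
    refine linearIndependent_of_reduction
      (reduction n ∘ₗ (highestWeightSpace n l).subtype) (n := n) ?_
    have : (fun b : B => (reduction n ∘ₗ (highestWeightSpace n l).subtype) (w b)) =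
        Subtype.val := funext hw
    rw [this]
    exact hB
  have hFli := hwli.of_isLocalizedModule LField (nonZeroDivisors LRing)
    (TensorProduct.mk LRing LField (highestWeightSpace n l) 1)
  have : Finite B := hFli.finite
  have : Fintype B := Fintype.ofFinite B
  have hcard : Fintype.card (DegreeIndex n l) ≤ Fintype.card B := by
    have hli : LinearIndependent SField fun b : DegreeIndex n l =>
        diffHom sK n (MvPolynomial.monomial b.1 1) := by
      have h1 := (MvPolynomial.basisMonomials (Fin (n - 1)) SField).linearIndependent.comp
        (Subtype.val : DegreeIndex n l → _) Subtype.val_injective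
      have h2 := h1.map' (diffHom sK n).toLinearMap
        (LinearMap.ker_eq_bot.mpr (diffHom_injective sK))
      have h3 : (fun b : DegreeIndex n l => diffHom sK n (MvPolynomial.monomial b.1 1)) =
          (diffHom sK n).toLinearMap ∘ MvPolynomial.basisMonomials (Fin (n - 1)) SField ∘
            Subtype.val := by
        funext b; simp
      rw [h3]
      exact h2
    have := linearIndependent_le_span' _ hli B (by
      rintro _ ⟨b, rfl⟩
      rw [hBspan]
      exact hmem b.1 b.2)
    rwa [Cardinal.mk_fintype, Nat.cast_le] at this
  have htop := hFli.span_eq_top_of_card_eq_finrank'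
    (le_antisymm hFli.fintype_card_le_finrank (hrank.trans hcard))
  rw [eq_top_iff, ← htop, Submodule.span_le]
  rintro _ ⟨b, rfl⟩
  exact hwU b

theorem nontrivial_baseChange (hn : 2 ≤ n) (l : ℕ) :
    Nontrivial (LField ⊗[LRing] highestWeightSpace n l) := by
  let i : Fin (n - 1) := ⟨0, by omega⟩
  refine nontrivial_of_ne
    (TensorProduct.mk LRing LField (highestWeightSpace n l) 1 ⟨_, strandVector_mem i l⟩) 0 ?_
  rw [Ne, ← map_zero (TensorProduct.mk LRing LField (highestWeightSpace n l) 1),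
    tmul_one_injective.eq_iff]
  exact fun h => strandVector_ne_zero i l (congrArg Subtype.val h)

theorem isIrreducible_braidRep (hn : 2 ≤ n) (l : ℕ) :
    (extendScalars LField (braidRep n l)).IsIrreducible := by
  have := nontrivial_baseChange hn l
  refine { exists_pair_ne := ⟨⊥, ⊤, fun h => ?_⟩, eq_bot_or_eq_top := fun U => ?_ }
  · exact bot_ne_top (α := Submodule LField (LField ⊗[LRing] highestWeightSpace n l))
      (congrArg Subrepresentation.toSubmodule h)
  · rw [or_iff_not_imp_left]
    intro hU
    refine Subrepresentation.toSubmodule_injective (eq_top_of_stable (by omega)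
      (fun h => hU (Subrepresentation.toSubmodule_injective h)) fun i w hw => ?_)
    exact U.apply_mem_toSubmodule (braidGen i) hw

end Irreducible

end VermaBraid

end

theorem theorem3 (n l : ℕ) (hn : 2 ≤ n) :
    ∃ ρ : Representation VermaBraid.LRing (VermaBraid.BraidGroup n)
        (VermaBraid.highestWeightSpace n l),
      (∀ (i : Fin (n - 1)) (w : VermaBraid.highestWeightSpace n l),
        (ρ (VermaBraid.braidGen i) w : VermaBraid.VermaPow n) =
          VermaBraid.braidOp n i (w : VermaBraid.VermaPow n)) ∧
      (VermaBraid.extendScalars VermaBraid.LField ρ).IsIrreducible :=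
  ⟨VermaBraid.braidRep n l, VermaBraid.braidRep_braidGen l,
    VermaBraid.isIrreducible_braidRep hn l⟩
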